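/- **Setting.** A *2-groupoid* is a (possibly weak) 2-category whose 2-arrows are invertible and whose 1-arrows are invertible up to a 2-arrow. Let $\mathcal{P}$ be a fibered 2-category in 2-groupoids above a topological space $X$: 2-groupoids $\mathcal{P}_U$ for $U\subseteq X$ open, inverse image 2-functors $f^*:\mathcal P_U\to\mathcal P_{U_1}$ for inclusions $f:U_1\subseteq U$ with $(1_U)^*=1$, natural transformations $(fg)^*\Rightarrow g^*f^*$, and modifications $\alpha_{f,g,h}$ between the two induced transformations $(fgh)^*\Rightarrow h^*g^*f^*$, which are coherent for four composable inclusions. (For example, $\mathcal{P}$ may be any $\mathcal{G}$-2-gerbe on $X$.) Let $(U_i)_{i\in I}$ be a family of open sets (for example an open covering of $X$); put $U_{ij}=U_i\cap U_j$, etc. Restrictions to smaller open sets, composed with the comparison 1-arrows $x|_W\to (x|_V)|_W$ and their quasi-inverses, are omitted from the notation. Composition is written in functional order. If $f:x\to y$ is a 1-arrow with a coherently chosen quasi-inverse $f^{-1}$ (an adjoint equivalence), then $f_*(u)=fuf^{-1}$ denotes conjugation by $f$, a monoidal functor from $\mathrm{Ar}(x,x)$ to $\mathrm{Ar}(y,y)$;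 it comes with *conjugation squares*, invertible 2-arrows $f_*(u)\,f\Rightarrow f\,u$. **First trivialization.** Let $x_i\in\mathcal{P}_{U_i}$, 1-arrows $\phi_{ij}:x_j\to x_i$ in $\mathcal{P}_{U_{ij}}$, 1-arrows $g_{ijk}:x_i\to x_i$ and 2-arrows $m_{ijk}:g_{ijk}\phi_{ik}\Rightarrow\phi_{ij}\phi_{jk}$ in $\mathcal{P}_{U_{ijk}}$ be given, and put $\lambda_{ij}=(\phi_{ij})_*$. Let $\nu_{ijkl}:\lambda_{ij}(g_{jkl})\,g_{ijl}\Rightarrow g_{ijk}\,g_{ikl}$ be the unique 2-arrow for which the cube with faces $m_{ijl},m_{jkl},m_{ikl},m_{ijk},\nu_{ijkl}$ and the conjugation square $\lambda_{ij}(g_{jkl})\phi_{ij}\Rightarrow\phi_{ij}g_{jkl}$ commutes, i.e. for which the two composite 2-arrows $$\lambda_{ij}(g_{jkl})\,g_{ijl}\,\phi_{il}\Rightarrow\phi_{ij}\phi_{jk}\phi_{kl}$$ formed from these faces coincide. For a 1-arrow $\gamma:x_k\to x_k$ let $$\{\widetilde m_{ijk},\gamma\}:g_{ijk}\,\lambda_{ik}(\gamma)\Rightarrow\lambda_{ij}\lambda_{jk}(\gamma)\,g_{ijk}$$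 be the unique 2-arrow for which the cube with two opposite faces $m_{ijk}$ connected by $\gamma$, with the conjugation squares of $\phi_{ik}$ and $\phi_{jk}$ at $\gamma$ and of $\phi_{ij}$ at $\lambda_{jk}(\gamma)$, and with last face $\{\widetilde m_{ijk},\gamma\}$, commutes. **Second trivialization and comparison.** Let $(x'_i,\phi'_{ij},g'_{ijk},m'_{ijk})$ be a second such choice, with associated $\lambda'_{ij}$, $\nu'_{ijkl}$, $\{\widetilde m'_{ijk},\gamma\}$. Let $\chi_i:x_i\to x'_i$ in $\mathcal{P}_{U_i}$, and 1-arrows $\vartheta_{ij}:x'_i\to x'_i$ and 2-arrows $\zeta_{ij}:\phi'_{ij}\chi_j\Rightarrow\vartheta_{ij}\chi_i\phi_{ij}$ in $\mathcal{P}_{U_{ij}}$ be given, and put $r_i=(\chi_i)_*$. Let $$b_{ijk}:g'_{ijk}\,\vartheta_{ik}\Rightarrow\lambda'_{ij}(\vartheta_{jk})\,\vartheta_{ij}\,r_i(g_{ijk})$$ be the unique 2-arrow for which the diagram with faces $m_{ijk},m'_{ijk},\zeta_{ij},\zeta_{jk},\zeta_{ik},b_{ijk}$ and the conjugation squares of $\phi'_{ij}$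 at $\vartheta_{jk}$ and of $\chi_i$ at $g_{ijk}$ commutes, i.e. for which the two composite 2-arrows $$g'_{ijk}\,\phi'_{ik}\,\chi_k\Rightarrow\lambda'_{ij}(\vartheta_{jk})\,\vartheta_{ij}\,\chi_i\,\phi_{ij}\,\phi_{jk}$$ formed from these faces coincide. For $\gamma:x_j\to x_j$ let $$\{\widetilde\zeta_{ij},\gamma\}:\vartheta_{ij}\,r_i(\lambda_{ij}(\gamma))\Rightarrow\lambda'_{ij}(r_j(\gamma))\,\vartheta_{ij}$$ be the unique 2-arrow for which the diagram with two opposite faces $\zeta_{ij}$ connected by $\gamma$, with the conjugation squares of $\chi_j$ and $\phi_{ij}$ at $\gamma$, of $\phi'_{ij}$ at $r_j(\gamma)$ and of $\chi_i$ at $\lambda_{ij}(\gamma)$, and with last face $\{\widetilde\zeta_{ij},\gamma\}$, commutes. **Statement.** For all $i,j,k,l$, above $U_{ijkl}$ (and above every open subset $V$ of it, all 2-arrows being formed there): 1. The cube of 2-arrows comparing $\nu_{ijkl}$ (top face) with $\nu'_{ijkl}$ (bottom face) commutes: the two composite 2-arrows $$\lambda'_{ij}(g'_{jkl})\,g'_{ijl}\,\vartheta_{il}\,\chi_i\Rightarrow\lambda'_{ij}\lambda'_{jk}(\vartheta_{kl})\,\lambda'_{ij}(\vartheta_{jk})\,\vartheta_{ij}\,\chi_i\,g_{ijk}\,g_{ikl}$$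 coincide, where the first is composed of $b_{ijl}$, $\lambda'_{ij}(b_{jkl})$, $\{\widetilde\zeta_{ij},g_{jkl}\}^{-1}$, the conjugation squares of $\chi_i$ at $g_{ijl}$ and at $\lambda_{ij}(g_{jkl})$, and $\nu_{ijkl}$, and the second is composed of $\nu'_{ijkl}$, $b_{ikl}$, $\{\widetilde m'_{ijk},\vartheta_{kl}\}$, $b_{ijk}$, and the conjugation squares of $\chi_i$ at $g_{ikl}$ and at $g_{ijk}$, in these orders and with the evident whiskerings. 2. The coboundary equation holds in $\mathrm{Ar}(x'_i,x'_i)$ (compositions of 2-arrows in functional order): $$({}^{\lambda'_{ij}\lambda'_{jk}(\vartheta_{kl})\,\lambda'_{ij}(\vartheta_{jk})\,\vartheta_{ij}}\,r_i(\nu_{ijkl}))\;({}^{\lambda'_{ij}\lambda'_{jk}(\vartheta_{kl})\,\lambda'_{ij}(\vartheta_{jk})}\{\widetilde\zeta_{ij},g_{jkl}\}^{-1})\;\lambda'_{ij}(b_{jkl})\;({}^{\lambda'_{ij}(g'_{jkl})}b_{ijl})$$ $$=({}^{\lambda'_{ij}\lambda'_{jk}(\vartheta_{kl})}b_{ijk})\;\{\widetilde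 m'_{ijk},\vartheta_{kl}\}\;({}^{g'_{ijk}}b_{ikl})\;\nu'_{ijkl},$$ an equality of 2-arrows $$\lambda'_{ij}(g'_{jkl})\,g'_{ijl}\,\vartheta_{il}\Rightarrow\lambda'_{ij}\lambda'_{jk}(\vartheta_{kl})\,\lambda'_{ij}(\vartheta_{jk})\,\vartheta_{ij}\,r_i(g_{ijk})\,r_i(g_{ikl}).$$ Here a left exponent denotes whiskering by the given 1-arrow, whiskerings by preceding 1-arrows are understood, and $r_i(\nu_{ijkl})$, $\lambda'_{ij}(b_{jkl})$ are formed with the monoidal constraints of the functors $r_i$, $\lambda'_{ij}$. -/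

import Mathlib

open CategoryTheory Bicategory TopologicalSpace

set_option linter.checkUnivs false

universe w v u t s

namespace TwoGerbes

section TwoGroupoids

/-! ### 2-groupoids -/

/-- A 2-groupoid: all 2-arrows are invertible, all 1-arrows are invertible up to a 2-arrow. -/
class IsTwoGroupoid (B : Type u) [Bicategory.{w, v} B] : Prop where
  isIso_two {a b : B} {f g : a ⟶ b} (η : f ⟶ g) : IsIso η
  exists_inverse {a b : B} (f : a ⟶ b) :
    ∃ f' : b ⟶ a, Nonempty (𝟙 a ≅ f ≫ f') ∧ Nonempty (f' ≫ f ≅ 𝟙 b)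

attribute [instance] IsTwoGroupoid.isIso_two

/-- A coherent choice of a quasi-inverse of a 1-arrow `f`, i.e. `f` completed to an adjoint
equivalence. -/
structure QuasiInverse {B : Type u} [Bicategory.{w, v} B] {a b : B} (f : a ⟶ b) where
  inv : b ⟶ a
  unit : 𝟙 a ≅ f ≫ inv
  counit : inv ≫ f ≅ 𝟙 b
  left_triangle : leftZigzagIso unit counit = λ_ f ≪≫ (ρ_ f).symm

theorem nonempty_quasiInverse {B : Type u} [Bicategory.{w, v} B] [IsTwoGroupoid B] {a b : B}
    (f : a ⟶ b) : Nonempty (QuasiInverse f) := by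
  obtain ⟨f', ⟨η⟩, ⟨ct⟩⟩ := IsTwoGroupoid.exists_inverse f
  exact ⟨⟨f', η, adjointifyCounit η ct, adjointifyCounit_left_triangle η ct⟩⟩

/-- Some coherent quasi-inverse. -/
noncomputable def someInverse {B : Type u} [Bicategory.{w, v} B] [IsTwoGroupoid B] {a b : B}
    (f : a ⟶ b) : QuasiInverse f :=
  Classical.choice (nonempty_quasiInverse f)

/-- Whiskering by a 1-arrow of a 2-groupoid is bijective on 2-arrows. -/
theorem existsUnique_whiskerLeft {B : Type u} [Bicategory.{w, v} B] [IsTwoGroupoid B] {a b c : B}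
    (f : a ⟶ b) {p q : b ⟶ c} (s : f ≫ p ⟶ f ≫ q) : ∃! η : p ⟶ q, f ◁ η = s := by
  have inj : ∀ {a b c : B} (f : a ⟶ b) {p q : b ⟶ c} (η θ : p ⟶ q),
      f ◁ η = f ◁ θ → η = θ := by
    intro a b c f p q η θ h
    obtain ⟨f', -, ⟨ct⟩⟩ := IsTwoGroupoid.exists_inverse f
    have key : ∀ ξ : p ⟶ q, 𝟙 b ◁ ξ =
        ct.inv ▷ p ≫ (α_ f' f p).hom ≫ f' ◁ (f ◁ ξ) ≫ (α_ f' f q).inv ≫ ct.hom ▷ q := by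
      intro ξ
      have h1 : f' ◁ (f ◁ ξ) = (α_ f' f p).inv ≫ (f' ≫ f) ◁ ξ ≫ (α_ f' f q).hom := by
        rw [comp_whiskerLeft]; simp
      rw [h1]
      simp only [Category.assoc, Iso.hom_inv_id_assoc]
      rw [whisker_exchange ct.hom ξ, ← Category.assoc (ct.inv ▷ p), ← comp_whiskerRight]
      simp
    have h2 : 𝟙 b ◁ η = 𝟙 b ◁ θ := by rw [key, key, h]
    simpa using h2
  obtain ⟨f', -, ⟨ct⟩⟩ := IsTwoGroupoid.exists_inverse f
  have ex : ∃ η : p ⟶ q, f ◁ η = s := by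
    refine ⟨(λ_ p).inv ≫ ct.inv ▷ p ≫ (α_ f' f p).hom ≫ f' ◁ s ≫ (α_ f' f q).inv ≫ ct.hom ▷ q ≫
      (λ_ q).hom, inj f' _ _ ?_⟩
    set η := (λ_ p).inv ≫ ct.inv ▷ p ≫ (α_ f' f p).hom ≫ f' ◁ s ≫ (α_ f' f q).inv ≫
      ct.hom ▷ q ≫ (λ_ q).hom with hη
    have h1 : f' ◁ (f ◁ η) = (α_ f' f p).inv ≫ (f' ≫ f) ◁ η ≫ (α_ f' f q).hom := by
      rw [comp_whiskerLeft]; simp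
    have h2 : (f' ≫ f) ◁ η = ct.hom ▷ p ≫ 𝟙 b ◁ η ≫ ct.inv ▷ q := by
      rw [← Category.assoc, ← whisker_exchange ct.hom η, Category.assoc, ← comp_whiskerRight]
      simp
    rw [h1, h2, id_whiskerLeft, hη]
    simp
  obtain ⟨η, hη⟩ := ex
  exact ⟨η, hη, fun θ hθ => inj f _ _ (hθ.trans hη.symm)⟩

/-- The variant of the previous fact for an equation which involves further 2-arrows. -/
theorem existsUnique_face {B : Type u} [Bicategory.{w, v} B] [IsTwoGroupoid B] {a b c : B}
    (f : a ⟶ b) {p q : b ⟶ c} {y z : a ⟶ c} [BicategoricalCoherence (f ≫ q) y]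
    (t : y ⟶ z) (s : f ≫ p ⟶ z) : ∃! η : p ⟶ q, f ◁ η ⊗≫ t = s := by
  obtain ⟨η, hη, hu⟩ := existsUnique_whiskerLeft f
    (s ≫ inv ((BicategoricalCoherence.iso (f := f ≫ q) (g := y)).hom ≫ t))
  refine ⟨η, ?_, fun θ hθ => hu θ ?_⟩
  · simp only [bicategoricalComp, hη]
    rw [Category.assoc, IsIso.inv_hom_id, Category.comp_id]
  · rw [← hθ]
    simp [bicategoricalComp]

/-- The same with a further 2-arrow on the left. -/
theorem existsUnique_face' {B : Type u} [Bicategory.{w, v} B] [IsTwoGroupoid B] {a b c : B}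
    (f : a ⟶ b) {p q : b ⟶ c} {x x' y z : a ⟶ c} [BicategoricalCoherence x' (f ≫ p)]
    [BicategoricalCoherence (f ≫ q) y] (r : x ⟶ x') (t : y ⟶ z) (s : x ⟶ z) :
    ∃! η : p ⟶ q, r ⊗≫ f ◁ η ⊗≫ t = s := by
  obtain ⟨η, hη, hu⟩ := existsUnique_face (q := q) f t
    (inv (r ≫ (BicategoricalCoherence.iso (f := x') (g := f ≫ p)).hom) ≫ s)
  have key : ∀ θ : p ⟶ q, r ⊗≫ f ◁ θ ⊗≫ t =
      (r ≫ (BicategoricalCoherence.iso (f := x') (g := f ≫ p)).hom) ≫ (f ◁ θ ⊗≫ t) :=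
    fun θ => (Category.assoc _ _ _).symm
  refine ⟨η, ?_, fun θ hθ => hu θ ?_⟩
  · dsimp only at hη ⊢
    rw [key, hη, IsIso.hom_inv_id_assoc]
  · dsimp only at hθ ⊢
    rw [← hθ, key, IsIso.inv_hom_id_assoc]

/-- If `p ≫ e ≅ q ≫ e` with `e` invertible then `p ≅ q`. -/
def cancelRight {B : Type u} [Bicategory.{w, v} B] {a b c : B} {e : b ⟶ c} (E : QuasiInverse e)
    {p q : a ⟶ b} (i : p ≫ e ≅ q ≫ e) : p ≅ q :=
  (ρ_ p).symm ≪≫ whiskerLeftIso p E.unit ≪≫ (α_ p e E.inv).symm ≪≫ whiskerRightIso i E.inv ≪≫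
    α_ q e E.inv ≪≫ whiskerLeftIso q E.unit.symm ≪≫ ρ_ q

/-- If `p ≫ e ≅ q` with `e` invertible then `p ≅ q ≫ e⁻¹`. -/
def moveRight {B : Type u} [Bicategory.{w, v} B] {a b c : B} {e : b ⟶ c} (E : QuasiInverse e)
    {p : a ⟶ b} {q : a ⟶ c} (i : p ≫ e ≅ q) : p ≅ q ≫ E.inv :=
  (ρ_ p).symm ≪≫ whiskerLeftIso p E.unit ≪≫ (α_ p e E.inv).symm ≪≫ whiskerRightIso i E.inv

namespace QuasiInverse

variable {B : Type u} [Bicategory.{w, v} B] {a b : B} {f : a ⟶ b} (F : QuasiInverse f)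

/-- `q ≫ e⁻¹ ≫ e ≅ q`. -/
def cancel {c : B} (q : c ⟶ b) : (q ≫ F.inv) ≫ f ≅ q :=
  α_ q F.inv f ≪≫ whiskerLeftIso q F.counit ≪≫ ρ_ q

/-- Conjugation by `f`, on objects of the monoidal category `Ar(a, a)`: `u ↦ f u f⁻¹`
(in the functional order of composition). -/
def conj (u : a ⟶ a) : b ⟶ b := F.inv ≫ u ≫ f

/-- Conjugation by `f`, on arrows of the monoidal category `Ar(a, a)`. -/
def conjMap {u u' : a ⟶ a} (η : u ⟶ u') : F.conj u ⟶ F.conj u' := F.inv ◁ η ▷ f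

/-- Conjugation by `f` is monoidal. -/
def conjComp (u u' : a ⟶ a) : F.conj (u ≫ u') ≅ F.conj u ≫ F.conj u' :=
  whiskerLeftIso F.inv (α_ u u' f) ≪≫ (α_ F.inv u (u' ≫ f)).symm ≪≫
    whiskerLeftIso (F.inv ≫ u) ((λ_ (u' ≫ f)).symm ≪≫ whiskerRightIso F.unit (u' ≫ f) ≪≫
      α_ f F.inv (u' ≫ f)) ≪≫
    (α_ (F.inv ≫ u) f (F.inv ≫ u' ≫ f)).symm ≪≫
    whiskerRightIso (α_ F.inv u f) (F.inv ≫ u' ≫ f)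

/-- The 2-arrow filling the square with sides `u`, `f` and `f`, `f u f⁻¹`. -/
def sq (u : a ⟶ a) : f ≫ F.conj u ≅ u ≫ f :=
  (α_ f F.inv (u ≫ f)).symm ≪≫ whiskerRightIso F.unit.symm (u ≫ f) ≪≫ λ_ (u ≫ f)

end QuasiInverse

/-- Let `m : p ≫ g ⟶ q₁ ≫ q₂` be a 2-arrow between paths from `x` to `y`, and `γ : x ⟶ x`.
This says that `br` is the 2-arrow `{m̃, γ}`, i.e. that the following cube commutes: two opposite
faces are copies of `m`, connected by the arrow `γ`, three of the four other faces are the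
conjugation squares of `p` and `γ`, of `q₁` and `γ`, and of `q₂` and `q₁ γ q₁⁻¹`, and the
last one is `br`. -/
def IsBracket {B : Type u} [Bicategory.{w, v} B] {x x' y : B} {p : x ⟶ y} {g : y ⟶ y} {q₁ : x ⟶ x'}
    {q₂ : x' ⟶ y} (m : p ≫ g ⟶ q₁ ≫ q₂) (P : QuasiInverse p) (Q₁ : QuasiInverse q₁)
    (Q₂ : QuasiInverse q₂) (γ : x ⟶ x) (br : P.conj γ ≫ g ⟶ g ≫ Q₂.conj (Q₁.conj γ)) : Prop :=
  p ◁ br ⊗≫ m ▷ Q₂.conj (Q₁.conj γ) ⊗≫ q₁ ◁ (Q₂.sq (Q₁.conj γ)).hom ⊗≫ (Q₁.sq γ).hom ▷ q₂ =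
    (α_ p (P.conj γ) g).inv ≫ (P.sq γ).hom ▷ g ⊗≫ γ ◁ m ⊗≫ 𝟙 ((γ ≫ q₁) ≫ q₂)

theorem existsUnique_isBracket {B : Type u} [Bicategory.{w, v} B] [IsTwoGroupoid B] {x x' y : B}
    {p : x ⟶ y} {g : y ⟶ y} {q₁ : x ⟶ x'} {q₂ : x' ⟶ y} (m : p ≫ g ⟶ q₁ ≫ q₂)
    (P : QuasiInverse p) (Q₁ : QuasiInverse q₁) (Q₂ : QuasiInverse q₂) (γ : x ⟶ x) :
    ∃! br, IsBracket m P Q₁ Q₂ γ br :=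
  existsUnique_face p _ _

/-- The 2-arrow `{m̃, γ}`, the unique one for which the cube commutes. -/
noncomputable def bracket {B : Type u} [Bicategory.{w, v} B] [IsTwoGroupoid B] {x x' y : B}
    {p : x ⟶ y} {g : y ⟶ y} {q₁ : x ⟶ x'} {q₂ : x' ⟶ y} (m : p ≫ g ⟶ q₁ ≫ q₂)
    (P : QuasiInverse p) (Q₁ : QuasiInverse q₁) (Q₂ : QuasiInverse q₂) (γ : x ⟶ x) :
    P.conj γ ≫ g ⟶ g ≫ Q₂.conj (Q₁.conj γ) :=
  (existsUnique_isBracket m P Q₁ Q₂ γ).choose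

/-- Let `z : c ≫ f' ⟶ f ≫ d ≫ th` be a 2-arrow between paths from `x₁` to `y₂`, and
`γ : x₁ ⟶ x₁`. This says that `br` is the 2-arrow `{z̃, γ}`, i.e. that the following diagram
commutes: two opposite faces are copies of `z`, connected by the arrow `γ`, the other faces are
the conjugation squares of `c` and `γ`, of `f'` and `c γ c⁻¹`, of `f` and `γ`, and of `d` and
`f γ f⁻¹`, and `br`, between the two self-arrows so obtained and `th`. -/
def IsBracket' {B : Type u} [Bicategory.{w, v} B] [IsTwoGroupoid B] {x₁ x₂ y₁ y₂ : B}
    {c : x₁ ⟶ y₁} {f' : y₁ ⟶ y₂} {f : x₁ ⟶ x₂} {d : x₂ ⟶ y₂} {th : y₂ ⟶ y₂}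
    (z : c ≫ f' ⟶ f ≫ d ≫ th) (C : QuasiInverse c) (F' : QuasiInverse f') (F : QuasiInverse f)
    (D : QuasiInverse d) (γ : x₁ ⟶ x₁)
    (br : D.conj (F.conj γ) ≫ th ⟶ th ≫ F'.conj (C.conj γ)) : Prop :=
  (f ≫ d) ◁ br ⊗≫ inv z ▷ F'.conj (C.conj γ) ⊗≫ c ◁ (F'.sq (C.conj γ)).hom ⊗≫
      (C.sq γ).hom ▷ f' =
    (α_ f d (D.conj (F.conj γ) ≫ th)).hom ≫ f ◁ (α_ d (D.conj (F.conj γ)) th).inv ≫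
      f ◁ (D.sq (F.conj γ)).hom ▷ th ⊗≫ (F.sq γ).hom ▷ (d ≫ th) ⊗≫ γ ◁ inv z ⊗≫
      𝟙 ((γ ≫ c) ≫ f')

theorem existsUnique_isBracket' {B : Type u} [Bicategory.{w, v} B] [IsTwoGroupoid B]
    {x₁ x₂ y₁ y₂ : B} {c : x₁ ⟶ y₁} {f' : y₁ ⟶ y₂} {f : x₁ ⟶ x₂} {d : x₂ ⟶ y₂} {th : y₂ ⟶ y₂}
    (z : c ≫ f' ⟶ f ≫ d ≫ th) (C : QuasiInverse c) (F' : QuasiInverse f') (F : QuasiInverse f)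
    (D : QuasiInverse d) (γ : x₁ ⟶ x₁) : ∃! br, IsBracket' z C F' F D γ br :=
  existsUnique_face (f ≫ d) _ _

/-- The 2-arrow `{z̃, γ}`, the unique one for which the diagram commutes. -/
noncomputable def bracket' {B : Type u} [Bicategory.{w, v} B] [IsTwoGroupoid B]
    {x₁ x₂ y₁ y₂ : B} {c : x₁ ⟶ y₁} {f' : y₁ ⟶ y₂} {f : x₁ ⟶ x₂} {d : x₂ ⟶ y₂} {th : y₂ ⟶ y₂}
    (z : c ≫ f' ⟶ f ≫ d ≫ th) (C : QuasiInverse c) (F' : QuasiInverse f') (F : QuasiInverse f)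
    (D : QuasiInverse d) (γ : x₁ ⟶ x₁) :
    D.conj (F.conj γ) ≫ th ⟶ th ≫ F'.conj (C.conj γ) :=
  (existsUnique_isBracket' z C F' F D γ).choose

end TwoGroupoids

section Fibered

/-! ### Fibered 2-categories in 2-groupoids above a space -/

/-- The data of the fibers, of the inverse image 2-functors and of the comparison transformations
`(fg)^* ⟹ g^* f^*` of a fibered 2-category. -/
structure PreFibered (X : Type t) [TopologicalSpace X] where
  /-- The 2-groupoid above an open set. -/
  Fib : Opens X → Type u
  [bicategory : ∀ U, Bicategory.{w, v} (Fib U)]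
  [isTwoGroupoid : ∀ U, IsTwoGroupoid (Fib U)]
  /-- The inverse image 2-functor of an inclusion. -/
  res {U V : Opens X} (h : V ≤ U) : Pseudofunctor (Fib U) (Fib V)
  res_id (U : Opens X) : res (le_refl U) = Pseudofunctor.id (Fib U)
  /-- The natural transformation `(fg)^* ⟹ g^* f^*`. -/
  comp {U V W : Opens X} (h : V ≤ U) (k : W ≤ V) :
    Pseudofunctor.StrongTrans (res (k.trans h)) ((res h).comp (res k))

attribute [instance] PreFibered.bicategory PreFibered.isTwoGroupoid

namespace PreFibered

variable {X : Type t} [TopologicalSpace X] (P : PreFibered.{w, v, u, t} X)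

/-- The restriction `x|V` of an object. -/
abbrev obj {U V : Opens X} (h : V ≤ U) (x : P.Fib U) : P.Fib V := (P.res h).obj x

/-- The 1-arrow `x|W ⟶ (x|V)|W`, a component of `(fg)^* ⟹ g^* f^*`. -/
def e {U V W : Opens X} (h : V ≤ U) (k : W ≤ V) (x : P.Fib U) :
    P.obj (k.trans h) x ⟶ P.obj k (P.obj h x) := (P.comp h k).app x

/-- The naturality 2-arrow of `(fg)^* ⟹ g^* f^*`. -/
def eNat {U V W : Opens X} (h : V ≤ U) (k : W ≤ V) {x y : P.Fib U} (a : x ⟶ y) :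
    (P.res (k.trans h)).map a ≫ P.e h k y ≅ P.e h k x ≫ (P.res k).map ((P.res h).map a) :=
  (P.comp h k).naturality a

/-- The image of a square of 1-arrows by an inverse image 2-functor. -/
def mapSquare {U V : Opens X} (h : V ≤ U) {x y y' z : P.Fib U} {a : x ⟶ y} {b : y ⟶ z}
    {a' : x ⟶ y'} {b' : y' ⟶ z} (i : a ≫ b ≅ a' ≫ b') :
    (P.res h).map a ≫ (P.res h).map b ≅ (P.res h).map a' ≫ (P.res h).map b' :=
  ((P.res h).mapComp a b).symm ≪≫ (P.res h).map₂Iso i ≪≫ (P.res h).mapComp a' b'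

end PreFibered

/-- A fibered 2-category in 2-groupoids above a space `X`: there are moreover modifications
`α_{f,g,h}` between the two composites `(fgh)^* ⟹ h^* g^* f^*`, and these are coherent. -/
structure FiberedTwoCategory (X : Type t) [TopologicalSpace X] extends
    PreFibered.{w, v, u, t} X where
  /-- The component of `α_{f,g,h}` at an object. -/
  assoc {U₀ U₁ U₂ U₃ : Opens X} (f : U₁ ≤ U₀) (g : U₂ ≤ U₁) (h : U₃ ≤ U₂) (x : Fib U₀) :
    toPreFibered.e (g.trans f) h x ≫ (res h).map (toPreFibered.e f g x) ≅
      toPreFibered.e f (h.trans g) x ≫ toPreFibered.e g h (toPreFibered.obj f x)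
  /-- `α_{f,g,h}` is a modification. -/
  assoc_naturality {U₀ U₁ U₂ U₃ : Opens X} (f : U₁ ≤ U₀) (g : U₂ ≤ U₁) (h : U₃ ≤ U₂)
    {x y : Fib U₀} (a : x ⟶ y) :
    (toPreFibered.eNat (g.trans f) h a).hom ▷ (res h).map (toPreFibered.e f g y) ⊗≫
        toPreFibered.e (g.trans f) h x ◁ (toPreFibered.mapSquare h (toPreFibered.eNat f g a)).hom ⊗≫
        (assoc f g h x).hom ▷ (res h).map ((res g).map ((res f).map a)) =
      (α_ _ _ _).hom ≫ (res (h.trans (g.trans f))).map a ◁ (assoc f g h y).hom ⊗≫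
        (toPreFibered.eNat f (h.trans g) a).hom ▷ toPreFibered.e g h (toPreFibered.obj f y) ⊗≫
        toPreFibered.e f (h.trans g) x ◁ (toPreFibered.eNat g h ((res f).map a)).hom ≫
        (α_ _ _ _).inv
  /-- The two ways of comparing the composites `(fghk)^* ⟹ k^* h^* g^* f^*` by means of the
  modifications `α` coincide. -/
  assoc_coherence {U₀ U₁ U₂ U₃ U₄ : Opens X} (f : U₁ ≤ U₀) (g : U₂ ≤ U₁) (h : U₃ ≤ U₂)
    (k : U₄ ≤ U₃) (x : Fib U₀) :
    toPreFibered.e (h.trans (g.trans f)) k x ◁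
          (toPreFibered.mapSquare k (assoc f g h x)).hom ⊗≫
        (assoc f (h.trans g) k x).hom ▷ (res k).map (toPreFibered.e g h (toPreFibered.obj f x)) ⊗≫
        toPreFibered.e f (k.trans (h.trans g)) x ◁ (assoc g h k (toPreFibered.obj f x)).hom =
      (α_ _ _ _).inv ≫
        (assoc (g.trans f) h k x).hom ▷ (res k).map ((res h).map (toPreFibered.e f g x)) ⊗≫
        toPreFibered.e (g.trans f) (k.trans h) x ◁
          (toPreFibered.eNat h k (toPreFibered.e f g x)).inv ⊗≫
        (assoc f g (k.trans h) x).hom ▷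
          toPreFibered.e h k (toPreFibered.obj g (toPreFibered.obj f x)) ≫
        (α_ _ _ _).hom

namespace FiberedTwoCategory

variable {X : Type t} [TopologicalSpace X] (P : FiberedTwoCategory.{w, v, u, t} X)

/-- The restriction to `W` of a 1-arrow `a : x|V ⟶ y|V` above `V`, where `x` and `y` are objects
above open sets which contain `V`. -/
noncomputable def restr {U U' V W : Opens X} {x : P.Fib U} {y : P.Fib U'} (h : V ≤ U) (h' : V ≤ U')
    (k : W ≤ V) (a : P.obj h x ⟶ P.obj h' y) : P.obj (k.trans h) x ⟶ P.obj (k.trans h') y :=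
  (P.e h k x ≫ (P.res k).map a) ≫ (someInverse (P.e h' k y)).inv

/-- The square which characterizes the restriction of a 1-arrow. -/
noncomputable def restrSq {U U' V W : Opens X} {x : P.Fib U} {y : P.Fib U'} (h : V ≤ U)
    (h' : V ≤ U') (k : W ≤ V) (a : P.obj h x ⟶ P.obj h' y) :
    P.restr h h' k a ≫ P.e h' k y ≅ P.e h k x ≫ (P.res k).map a :=
  (someInverse (P.e h' k y)).cancel _

/-- The restriction to `W` of a 2-arrow above `V`. -/
noncomputable def restr₂ {U U' V W : Opens X} {x : P.Fib U} {y : P.Fib U'} (h : V ≤ U)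
    (h' : V ≤ U') (k : W ≤ V) {a b : P.obj h x ⟶ P.obj h' y} (η : a ⟶ b) :
    P.restr h h' k a ⟶ P.restr h h' k b :=
  (P.e h k x ◁ (P.res k).map₂ η) ▷ (someInverse (P.e h' k y)).inv

/-- Restriction of 1-arrows is compatible with composition. -/
noncomputable def restrComp {U U' U'' V W : Opens X} {x : P.Fib U} {y : P.Fib U'} {z : P.Fib U''}
    (h : V ≤ U) (h' : V ≤ U') (h'' : V ≤ U'') (k : W ≤ V) (a : P.obj h x ⟶ P.obj h' y)
    (b : P.obj h' y ⟶ P.obj h'' z) :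
    P.restr h h'' k (a ≫ b) ≅ P.restr h h' k a ≫ P.restr h' h'' k b :=
  (moveRight (someInverse (P.e h'' k z))
    (α_ _ _ _ ≪≫ whiskerLeftIso _ (P.restrSq h' h'' k b) ≪≫ (α_ _ _ _).symm ≪≫
      whiskerRightIso (P.restrSq h h' k a) _ ≪≫ α_ _ _ _ ≪≫
      whiskerLeftIso _ ((P.res k).mapComp a b).symm)).symm

/-- The restriction to `W` of the restriction to `V` of a 1-arrow `a : x ⟶ y` above `U` is the
restriction of `a` to `W`. -/
noncomputable def restrMap {U V W : Opens X} {x y : P.Fib U} (h : V ≤ U) (k : W ≤ V) (a : x ⟶ y) :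
    P.restr h h k ((P.res h).map a) ≅ (P.res (k.trans h)).map a :=
  (moveRight (someInverse (P.e h k y)) (P.eNat h k a)).symm

/-- The restriction to `W` of the restriction to `V'` of a 1-arrow `a : x|V ⟶ y|V` above `V` is the
restriction of `a` to `W`. -/
noncomputable def restrRestr {U U' V V' W : Opens X} {x : P.Fib U} {y : P.Fib U'} (h : V ≤ U)
    (h' : V ≤ U') (k : V' ≤ V) (l : W ≤ V') (a : P.obj h x ⟶ P.obj h' y) :
    P.restr (k.trans h) (k.trans h') l (P.restr h h' k a) ≅ P.restr h h' (l.trans k) a :=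
  moveRight (someInverse (P.e h' (l.trans k) y))
    (cancelRight (someInverse (P.e k l (P.obj h' y)))
      (α_ _ _ _ ≪≫ whiskerLeftIso _ (P.assoc h' k l y).symm ≪≫ (α_ _ _ _).symm ≪≫
        whiskerRightIso (P.restrSq (k.trans h) (k.trans h') l (P.restr h h' k a)) _ ≪≫
        α_ _ _ _ ≪≫ whiskerLeftIso _ (P.mapSquare l (P.restrSq h h' k a)) ≪≫
        (α_ _ _ _).symm ≪≫ whiskerRightIso (P.assoc h k l x) _ ≪≫ α_ _ _ _ ≪≫
        whiskerLeftIso _ (P.eNat k l a).symm ≪≫ (α_ _ _ _).symm))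

end FiberedTwoCategory

end Fibered

section Cocycles

/-! ### Local trivializations and the cocycles which they determine -/

variable {X : Type t} [TopologicalSpace X] {I : Type s} {P : FiberedTwoCategory.{w, v, u, t} X}
  {U : I → Opens X}

theorem le_i (i j k : I) : U i ⊓ U j ⊓ U k ≤ U i := inf_le_left.trans inf_le_left
theorem le_j (i j k : I) : U i ⊓ U j ⊓ U k ≤ U j := inf_le_left.trans inf_le_right
theorem le_k (i j k : I) : U i ⊓ U j ⊓ U k ≤ U k := inf_le_right

/-- Local objects `x i` above `U i`, paths `φ i j : x j ⟶ x i` above `U i ∩ U j`, together with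
objects `g i j k` and 2-arrows `m i j k` above `U i ∩ U j ∩ U k`

```
       x k --- φ j k ---> x j
        |                  |
      φ i k              φ i j
        v                  v
       x i --- g i j k -> x i
```
and coherent quasi-inverses of the restrictions of the paths to smaller open sets. -/
structure Trivialization (P : FiberedTwoCategory.{w, v, u, t} X) (U : I → Opens X) where
  x (i : I) : P.Fib (U i)
  φ (i j : I) : P.obj (inf_le_right : U i ⊓ U j ≤ U j) (x j) ⟶
    P.obj (inf_le_left : U i ⊓ U j ≤ U i) (x i)
  φInv (i j : I) {V : Opens X} (hi : V ≤ U i) (hj : V ≤ U j) :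
    QuasiInverse (P.restr inf_le_right inf_le_left (le_inf hi hj) (φ i j))
  g (i j k : I) : P.obj (le_i i j k) (x i) ⟶ P.obj (le_i i j k) (x i)
  m (i j k : I) :
    P.restr inf_le_right inf_le_left (le_inf (le_i i j k) (le_k i j k)) (φ i k) ≫ g i j k ⟶
      P.restr inf_le_right inf_le_left (le_inf (le_j i j k) (le_k i j k)) (φ j k) ≫
        P.restr inf_le_right inf_le_left (le_inf (le_i i j k) (le_j i j k)) (φ i j)

namespace Trivialization

variable (T : Trivialization P U) {V : Opens X} {i j k l : I}

/-- `x i`, above `V`. -/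
abbrev xr (hi : V ≤ U i) : P.Fib V := P.obj hi (T.x i)

/-- `φ i j`, above `V`. -/
noncomputable def φr (hi : V ≤ U i) (hj : V ≤ U j) : T.xr hj ⟶ T.xr hi :=
  P.restr inf_le_right inf_le_left (le_inf hi hj) (T.φ i j)

/-- The quasi-inverse of `φ i j`, above `V`. -/
def φrInv (hi : V ≤ U i) (hj : V ≤ U j) : QuasiInverse (T.φr hi hj) :=
  T.φInv i j hi hj

/-- `λ i j`, above `V`: conjugation by `φ i j`. -/
noncomputable def lam (hi : V ≤ U i) (hj : V ≤ U j) (u : T.xr hj ⟶ T.xr hj) : T.xr hi ⟶ T.xr hi :=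
  (T.φrInv hi hj).conj u

/-- The conjugation square of `φ i j`. -/
noncomputable def sq (hi : V ≤ U i) (hj : V ≤ U j) (u : T.xr hj ⟶ T.xr hj) :
    T.φr hi hj ≫ T.lam hi hj u ≅ u ≫ T.φr hi hj :=
  (T.φrInv hi hj).sq u

/-- `g i j k`, above `V`. -/
noncomputable def gr (hi : V ≤ U i) (hj : V ≤ U j) (hk : V ≤ U k) : T.xr hi ⟶ T.xr hi :=
  P.restr (le_i i j k) (le_i i j k) (le_inf (le_inf hi hj) hk) (T.g i j k)

/-- `m i j k`, above `V`. -/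
noncomputable def mr (hi : V ≤ U i) (hj : V ≤ U j) (hk : V ≤ U k) :
    T.φr hi hk ≫ T.gr hi hj hk ⟶ T.φr hj hk ≫ T.φr hi hj :=
  (P.restrRestr inf_le_right inf_le_left (le_inf (le_i i j k) (le_k i j k))
      (le_inf (le_inf hi hj) hk) (T.φ i k)).inv ▷ T.gr hi hj hk ≫
    (P.restrComp (le_k i j k) (le_i i j k) (le_i i j k) (le_inf (le_inf hi hj) hk) _ _).inv ≫
    P.restr₂ (le_k i j k) (le_i i j k) (le_inf (le_inf hi hj) hk) (T.m i j k) ≫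
    (P.restrComp (le_k i j k) (le_j i j k) (le_i i j k) (le_inf (le_inf hi hj) hk) _ _).hom ≫
    (P.restrRestr inf_le_right inf_le_left (le_inf (le_j i j k) (le_k i j k))
      (le_inf (le_inf hi hj) hk) (T.φ j k)).hom ▷ _ ≫
    T.φr hj hk ◁ (P.restrRestr inf_le_right inf_le_left (le_inf (le_i i j k) (le_j i j k))
      (le_inf (le_inf hi hj) hk) (T.φ i j)).hom

/-- The commutativity of the cube with faces `m i j l`, `m j k l`, `m i k l`, `m i j k`, `n` and the
conjugation square of `φ i j` and `g j k l`. -/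
def IsNu (hi : V ≤ U i) (hj : V ≤ U j) (hk : V ≤ U k) (hl : V ≤ U l)
    (n : T.gr hi hj hl ≫ T.lam hi hj (T.gr hj hk hl) ⟶ T.gr hi hk hl ≫ T.gr hi hj hk) : Prop :=
  T.φr hi hl ◁ n ⊗≫ T.mr hi hk hl ▷ T.gr hi hj hk ⊗≫ T.φr hk hl ◁ T.mr hi hj hk =
    (α_ _ _ _).inv ≫ T.mr hi hj hl ▷ T.lam hi hj (T.gr hj hk hl) ⊗≫
      T.φr hj hl ◁ (T.sq hi hj (T.gr hj hk hl)).hom ⊗≫ T.mr hj hk hl ▷ T.φr hi hj ≫ (α_ _ _ _).hom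

theorem existsUnique_isNu (hi : V ≤ U i) (hj : V ≤ U j) (hk : V ≤ U k) (hl : V ≤ U l) :
    ∃! n, T.IsNu hi hj hk hl n :=
  existsUnique_face (T.φr hi hl) _ _

/-- `ν i j k l`, above `V`: the unique 2-arrow which makes the above cube commute. -/
noncomputable def nu (hi : V ≤ U i) (hj : V ≤ U j) (hk : V ≤ U k) (hl : V ≤ U l) :
    T.gr hi hj hl ≫ T.lam hi hj (T.gr hj hk hl) ⟶ T.gr hi hk hl ≫ T.gr hi hj hk :=
  (T.existsUnique_isNu hi hj hk hl).choose

/-- `{m̃ i j k, γ}`, above `V`. -/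
noncomputable def mBracket (hi : V ≤ U i) (hj : V ≤ U j) (hk : V ≤ U k) (γ : T.xr hk ⟶ T.xr hk) :
    T.lam hi hk γ ≫ T.gr hi hj hk ⟶ T.gr hi hj hk ≫ T.lam hi hj (T.lam hj hk γ) :=
  bracket (T.mr hi hj hk) (T.φrInv hi hk) (T.φrInv hj hk) (T.φrInv hi hj) γ

end Trivialization

/-- The comparison of two local trivializations: 1-arrows `χ i : x i ⟶ x' i` above `U i`, and
1-arrows `ϑ i j : x' i ⟶ x' i` and 2-arrows `ζ i j` above `U i ∩ U j`

```
       x j --- φ i j ---> x i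
        |                  |
        |                 χ i
        |                  v
       χ j               x' i
        |                  |
        |                ϑ i j
        v                  v
      x' j -- φ' i j ---> x' i
```
and coherent quasi-inverses of the restrictions of the `χ i` to smaller open sets. -/
structure Comparison (T T' : Trivialization P U) where
  χ (i : I) : T.x i ⟶ T'.x i
  χInv (i : I) {V : Opens X} (hi : V ≤ U i) : QuasiInverse ((P.res hi).map (χ i))
  ϑ (i j : I) : P.obj (inf_le_left : U i ⊓ U j ≤ U i) (T'.x i) ⟶
    P.obj (inf_le_left : U i ⊓ U j ≤ U i) (T'.x i)
  ζ (i j : I) : (P.res inf_le_right).map (χ j) ≫ T'.φ i j ⟶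
    T.φ i j ≫ (P.res inf_le_left).map (χ i) ≫ ϑ i j

namespace Comparison

variable {T T' : Trivialization P U} (K : Comparison T T') {V : Opens X} {i j k l : I}

/-- `χ i`, above `V`. -/
def χr (hi : V ≤ U i) : T.xr hi ⟶ T'.xr hi := (P.res hi).map (K.χ i)

/-- The quasi-inverse of `χ i`, above `V`. -/
def χrInv (hi : V ≤ U i) : QuasiInverse (K.χr hi) := K.χInv i hi

/-- `r i`, above `V`: conjugation by `χ i`. -/
def r (hi : V ≤ U i) (u : T.xr hi ⟶ T.xr hi) : T'.xr hi ⟶ T'.xr hi := (K.χrInv hi).conj u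

/-- The conjugation square of `χ i`. -/
def sq (hi : V ≤ U i) (u : T.xr hi ⟶ T.xr hi) : K.χr hi ≫ K.r hi u ≅ u ≫ K.χr hi :=
  (K.χrInv hi).sq u

/-- `ϑ i j`, above `V`. -/
noncomputable def ϑr (hi : V ≤ U i) (hj : V ≤ U j) : T'.xr hi ⟶ T'.xr hi :=
  P.restr inf_le_left inf_le_left (le_inf hi hj) (K.ϑ i j)

/-- `ζ i j`, above `V`. -/
noncomputable def ζr (hi : V ≤ U i) (hj : V ≤ U j) :
    K.χr hj ≫ T'.φr hi hj ⟶ T.φr hi hj ≫ K.χr hi ≫ K.ϑr hi hj :=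
  (P.restrMap inf_le_right (le_inf hi hj) (K.χ j)).inv ▷ T'.φr hi hj ≫
    (P.restrComp inf_le_right inf_le_right inf_le_left (le_inf hi hj) _ _).inv ≫
    P.restr₂ inf_le_right inf_le_left (le_inf hi hj) (K.ζ i j) ≫
    (P.restrComp inf_le_right inf_le_left inf_le_left (le_inf hi hj) _ _).hom ≫
    T.φr hi hj ◁ (P.restrComp inf_le_left inf_le_left inf_le_left (le_inf hi hj) _ _).hom ≫
    T.φr hi hj ◁ (P.restrMap inf_le_left (le_inf hi hj) (K.χ i)).hom ▷ K.ϑr hi hj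

/-- The commutativity of the diagram of 2-arrows with faces `m i j k`, `m' i j k`, `ζ i j`, `ζ j k`,
`ζ i k`, `b` and the conjugation squares of `χ i` and `g i j k`, and of `φ' i j` and `ϑ j k`. -/
def IsB (hi : V ≤ U i) (hj : V ≤ U j) (hk : V ≤ U k)
    (b : K.ϑr hi hk ≫ T'.gr hi hj hk ⟶
      K.r hi (T.gr hi hj hk) ≫ K.ϑr hi hj ≫ T'.lam hi hj (K.ϑr hj hk)) : Prop :=
  K.ζr hi hk ▷ T'.gr hi hj hk ⊗≫ (T.φr hi hk ≫ K.χr hi) ◁ b ⊗≫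
      T.φr hi hk ◁ (K.sq hi (T.gr hi hj hk)).hom ▷ (K.ϑr hi hj ≫ T'.lam hi hj (K.ϑr hj hk)) ⊗≫
      T.mr hi hj hk ▷ (K.χr hi ≫ K.ϑr hi hj ≫ T'.lam hi hj (K.ϑr hj hk)) ≫ (α_ _ _ _).hom =
    (α_ _ _ _).hom ≫ K.χr hk ◁ T'.mr hi hj hk ⊗≫ K.ζr hj hk ▷ T'.φr hi hj ⊗≫
      (T.φr hj hk ≫ K.χr hj) ◁ (T'.sq hi hj (K.ϑr hj hk)).inv ⊗≫
      T.φr hj hk ◁ K.ζr hi hj ▷ T'.lam hi hj (K.ϑr hj hk) ⊗≫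
      𝟙 (T.φr hj hk ≫ T.φr hi hj ≫ K.χr hi ≫ K.ϑr hi hj ≫ T'.lam hi hj (K.ϑr hj hk))

theorem existsUnique_isB (hi : V ≤ U i) (hj : V ≤ U j) (hk : V ≤ U k) :
    ∃! b, K.IsB hi hj hk b :=
  existsUnique_face' (T.φr hi hk ≫ K.χr hi) _ _ _

/-- `b i j k`, above `V`: the unique 2-arrow which makes the above diagram commute. -/
noncomputable def b (hi : V ≤ U i) (hj : V ≤ U j) (hk : V ≤ U k) :
    K.ϑr hi hk ≫ T'.gr hi hj hk ⟶
      K.r hi (T.gr hi hj hk) ≫ K.ϑr hi hj ≫ T'.lam hi hj (K.ϑr hj hk) :=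
  (K.existsUnique_isB hi hj hk).choose

/-- `{ζ̃ i j, γ}`, above `V`. -/
noncomputable def ζBracket (hi : V ≤ U i) (hj : V ≤ U j) (γ : T.xr hj ⟶ T.xr hj) :
    K.r hi (T.lam hi hj γ) ≫ K.ϑr hi hj ⟶ K.ϑr hi hj ≫ T'.lam hi hj (K.r hj γ) :=
  bracket' (K.ζr hi hj) (K.χrInv hj) (T'.φrInv hi hj) (T.φrInv hi hj) (K.χrInv hi) γ

/-- The face `r i (ν i j k l)`, above `V`. -/
noncomputable def rNu (hi : V ≤ U i) (hj : V ≤ U j) (hk : V ≤ U k) (hl : V ≤ U l) :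
    K.r hi (T.gr hi hj hl) ≫ K.r hi (T.lam hi hj (T.gr hj hk hl)) ⟶
      K.r hi (T.gr hi hk hl) ≫ K.r hi (T.gr hi hj hk) :=
  ((K.χrInv hi).conjComp _ _).inv ≫ (K.χrInv hi).conjMap (T.nu hi hj hk hl) ≫
    ((K.χrInv hi).conjComp _ _).hom

/-- The face `λ' i j (b j k l)`, above `V`. -/
noncomputable def lamB (hi : V ≤ U i) (hj : V ≤ U j) (hk : V ≤ U k) (hl : V ≤ U l) :
    T'.lam hi hj (K.ϑr hj hl) ≫ T'.lam hi hj (T'.gr hj hk hl) ⟶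
      T'.lam hi hj (K.r hj (T.gr hj hk hl)) ≫ T'.lam hi hj (K.ϑr hj hk) ≫
        T'.lam hi hj (T'.lam hj hk (K.ϑr hk hl)) :=
  ((T'.φrInv hi hj).conjComp _ _).inv ≫ (T'.φrInv hi hj).conjMap (K.b hj hk hl) ≫
    ((T'.φrInv hi hj).conjComp _ _).hom ≫
    T'.lam hi hj (K.r hj (T.gr hj hk hl)) ◁ ((T'.φrInv hi hj).conjComp _ _).hom

end Comparison

end Cocycles

end TwoGerbes

namespace TwoGerbes

/-! ### Naturality and monoidality of the conjugation squares. -/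

namespace QuasiInverse

variable {B : Type u} [Bicategory.{w, v} B] {a b : B} {f : a ⟶ b} (F : QuasiInverse f)

/-! Every 2-arrow in the statement is defined by a commuting cube, so the identity follows by
pasting these cubes. Whiskering with a 1-arrow of a 2-groupoid is faithful and all 2-arrows are
invertible, so the two composites of the full cube may be compared after whiskering with `φ i l`,
precomposing with `ζ i l`, and postcomposing with `m i k l` and `m i j k`.

Once extended in this way, both composites reduce to one 2-arrow that contains no `ν`, no `b` and no
bracket. It applies `m' i j l`, moves `g' j k l` through `φ' i j`, applies `m' j k l`, and then
applies `ζ k l`, `ζ j k`, `ζ i j` in turn, carrying `ϑ k l` and `ϑ j k` through the `φ'` by inverse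
conjugation squares. `first_composite` reaches it from the side of `ν` with the cubes of `ν`, `b i j
l`, `{ζ̃ i j, g j k l}`, `λ' i j (b j k l)` and `b j k l`. `second_composite` reaches it from the
side of `ν'` with the cubes of `b i k l`, `b i j k`, `{m̃' i j k, ϑ k l}` and `ν'`. Between uses of
the cubes only the interchange law (`whisker_exchange`) and coherence are needed.

The faces `λ' i j (b j k l)` and `r i (ν i j k l)` are formed with monoidal constraints. The
conjugation squares are natural and compatible with these constraints, so each such face has its own
commuting cube (`conjMap_comp₃_sq`, `conjMap_comp_sq`). The cube of `r i (ν i j k l)` also turns the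
full cube into the coboundary equation, after cancelling `χ i` (`coboundary_of_cube`).

Composition in the code is diagrammatic, so 1-arrows appear in the reverse of the functional order.
-/

theorem conjMap_sq {p q : a ⟶ a} (η : p ⟶ q) :
    f ◁ F.conjMap η ≫ (F.sq q).hom = (F.sq p).hom ≫ η ▷ f := by
  change f ◁ F.inv ◁ η ▷ f ≫ (α_ _ _ _).inv ≫ F.unit.inv ▷ (q ≫ f) ≫ (λ_ _).hom =
    ((α_ _ _ _).inv ≫ F.unit.inv ▷ (p ≫ f) ≫ (λ_ _).hom) ≫ η ▷ f
  calc
    _ = 𝟙 _ ⊗≫ ((f ≫ F.inv) ◁ (η ▷ f) ≫ F.unit.inv ▷ (q ≫ f)) ⊗≫ 𝟙 _ := by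
      bicategory
    _ = 𝟙 _ ⊗≫ (F.unit.inv ▷ (p ≫ f) ≫ 𝟙 a ◁ (η ▷ f)) ⊗≫ 𝟙 _ := by rw [whisker_exchange]
    _ = _ := by bicategory

/-- The constraint inserts `f ≫ f⁻¹` between `p` and `q` by the unit, and the square of `q` removes
it again by the inverse of the unit. What remains is the removal of the outer `f ≫ f⁻¹`, which is
the square of `p ≫ q`. -/
theorem conjComp_sq (p q : a ⟶ a) :
    f ◁ (F.conjComp p q).hom ≫ (α_ _ _ _).inv ≫ (F.sq p).hom ▷ F.conj q ≫ (α_ _ _ _).hom ≫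
      p ◁ (F.sq q).hom = (F.sq (p ≫ q)).hom ≫ (α_ _ _ _).hom := by
  change f ◁ (F.inv ◁ (α_ p q f).hom ≫ (α_ _ _ _).inv ≫ (F.inv ≫ p) ◁ ((λ_ _).inv ≫
        F.unit.hom ▷ (q ≫ f) ≫ (α_ _ _ _).hom) ≫ (α_ _ _ _).inv ≫
        (α_ _ _ _).hom ▷ (F.inv ≫ q ≫ f)) ≫ (α_ f (F.inv ≫ p ≫ f) (F.inv ≫ q ≫ f)).inv ≫
      ((α_ _ _ _).inv ≫ F.unit.inv ▷ (p ≫ f) ≫ (λ_ _).hom) ▷ (F.inv ≫ q ≫ f) ≫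
      (α_ _ _ _).hom ≫ p ◁ ((α_ _ _ _).inv ≫ F.unit.inv ▷ (q ≫ f) ≫ (λ_ _).hom) =
    ((α_ _ _ _).inv ≫ F.unit.inv ▷ ((p ≫ q) ≫ f) ≫ (λ_ _).hom) ≫ (α_ _ _ _).hom
  calc
    _ = 𝟙 _ ⊗≫ ((f ≫ F.inv) ◁ (p ◁ F.unit.hom ▷ (q ≫ f)) ≫
          F.unit.inv ▷ (p ≫ (f ≫ F.inv) ≫ (q ≫ f))) ⊗≫ p ◁ F.unit.inv ▷ (q ≫ f) ⊗≫ 𝟙 _ := by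
      bicategory
    -- Interchange lets the outer pair be removed first, so that the inserted unit meets its
    -- inverse.
    _ = 𝟙 _ ⊗≫ F.unit.inv ▷ (p ≫ q ≫ f) ⊗≫ p ◁ (F.unit.hom ≫ F.unit.inv) ▷ (q ≫ f) ⊗≫ 𝟙 _ := by
      rw [whisker_exchange]; bicategory
    _ = _ := by rw [Iso.hom_inv_id]; bicategory

end QuasiInverse

/-! ### The two pasting computations in a general bicategory. -/

section

variable {B : Type u} [Bicategory.{w, v} B] {xi xj xk xl yi yj yk yl : B}
  {fij : xj ⟶ xi} {fik : xk ⟶ xi} {fil : xl ⟶ xi} {fjk : xk ⟶ xj} {fjl : xl ⟶ xj} {fkl : xl ⟶ xk}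
  {pij : yj ⟶ yi} {pik : yk ⟶ yi} {pil : yl ⟶ yi} {pjk : yk ⟶ yj} {pjl : yl ⟶ yj} {pkl : yl ⟶ yk}
  {gijk gikl gijl : xi ⟶ xi} {gjkl : xj ⟶ xj}
  {hijk hikl hijl : yi ⟶ yi} {hjkl : yj ⟶ yj}
  {ci : xi ⟶ yi} {cj : xj ⟶ yj} {ck : xk ⟶ yk} {cl : xl ⟶ yl}
  {tij tik til : yi ⟶ yi} {tjk tjl : yj ⟶ yj} {tkl : yk ⟶ yk}
  {lh ltjk ltjl llt ltik lrg rlg rgikl rgijk rgijl : yi ⟶ yi} {lt rgjkl : yj ⟶ yj}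
  {lg : xi ⟶ xi}

/-- The side of `ν'`. Dictionary: `f`, `g`, `m` belong to the first trivialization and `p`, `h`, `n`
to the second (`φ'`, `g'`, `m'`); `c`, `t`, `z` are `χ`, `ϑ`, `ζ`. A prefix `l` stands for `λ` or
`λ'` and a prefix `r` for `r i` or `r j`: `lh` is `λ' i j (g' j k l)`, `lt` is `λ' j k (ϑ k l)` and
`llt` is `λ' i j` of it. The `s…` are conjugation squares. They enter only as invertible 2-arrows,
so the conjugates can be arbitrary 1-arrows. -/
theorem second_composite
    (nij : pil ≫ hijl ⟶ pjl ≫ pij) (njk : pjl ≫ hjkl ⟶ pkl ≫ pjk)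
    (nik : pil ≫ hikl ⟶ pkl ≫ pik) (n : pik ≫ hijk ⟶ pjk ≫ pij)
    (mik : fil ≫ gikl ⟶ fkl ≫ fik) (m : fik ≫ gijk ⟶ fjk ≫ fij)
    (zij : cj ≫ pij ⟶ fij ≫ ci ≫ tij) (zik : ck ≫ pik ⟶ fik ≫ ci ≫ tik)
    (zil : cl ≫ pil ⟶ fil ≫ ci ≫ til) (zjk : ck ≫ pjk ⟶ fjk ≫ cj ≫ tjk)
    (zkl : cl ≫ pkl ⟶ fkl ≫ ck ≫ tkl)
    (sh : pij ≫ lh ≅ hjkl ≫ pij) (sik : pik ≫ ltik ≅ tkl ≫ pik) (sjk : pjk ≫ lt ≅ tkl ≫ pjk)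
    (sll : pij ≫ llt ≅ lt ≫ pij) (st : pij ≫ ltjk ≅ tjk ≫ pij)
    (sgikl : ci ≫ rgikl ≅ gikl ≫ ci) (sgijk : ci ≫ rgijk ≅ gijk ≫ ci)
    (nu : hijl ≫ lh ⟶ hikl ≫ hijk)
    (hnu : pil ◁ nu ⊗≫ nik ▷ hijk ⊗≫ pkl ◁ n =
      (α_ _ _ _).inv ≫ nij ▷ lh ⊗≫ pjl ◁ sh.hom ⊗≫ njk ▷ pij ≫ (α_ _ _ _).hom)
    (br : ltik ≫ hijk ⟶ hijk ≫ llt)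
    (hbr : pik ◁ br ⊗≫ n ▷ llt ⊗≫ pjk ◁ sll.hom ⊗≫ sjk.hom ▷ pij =
      (α_ _ _ _).inv ≫ sik.hom ▷ hijk ⊗≫ tkl ◁ n ⊗≫ 𝟙 ((tkl ≫ pjk) ≫ pij))
    (bik : til ≫ hikl ⟶ rgikl ≫ tik ≫ ltik)
    (hbik : zil ▷ hikl ⊗≫ (fil ≫ ci) ◁ bik ⊗≫ fil ◁ sgikl.hom ▷ (tik ≫ ltik) ⊗≫
        mik ▷ (ci ≫ tik ≫ ltik) ≫ (α_ _ _ _).hom =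
      (α_ _ _ _).hom ≫ cl ◁ nik ⊗≫ zkl ▷ pik ⊗≫ (fkl ≫ ck) ◁ sik.inv ⊗≫
        fkl ◁ zik ▷ ltik ⊗≫ 𝟙 (fkl ≫ fik ≫ ci ≫ tik ≫ ltik))
    (b : tik ≫ hijk ⟶ rgijk ≫ tij ≫ ltjk)
    (hb : zik ▷ hijk ⊗≫ (fik ≫ ci) ◁ b ⊗≫ fik ◁ sgijk.hom ▷ (tij ≫ ltjk) ⊗≫
        m ▷ (ci ≫ tij ≫ ltjk) ≫ (α_ _ _ _).hom =
      (α_ _ _ _).hom ≫ ck ◁ n ⊗≫ zjk ▷ pij ⊗≫ (fjk ≫ cj) ◁ st.inv ⊗≫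
        fjk ◁ zij ▷ ltjk ⊗≫ 𝟙 (fjk ≫ fij ≫ ci ≫ tij ≫ ltjk)) :
    𝟙 ((cl ≫ pil) ≫ hijl ≫ lh) ⊗≫ zil ▷ (hijl ≫ lh) ⊗≫ (fil ≫ ci ≫ til) ◁ nu ⊗≫
        (fil ≫ ci) ◁ bik ▷ hijk ⊗≫
        (fil ≫ ci ≫ rgikl ≫ tik) ◁ br ⊗≫
        (fil ≫ ci ≫ rgikl) ◁ b ▷ llt ⊗≫
        fil ◁ sgikl.hom ▷ (rgijk ≫ tij ≫ ltjk ≫ llt) ⊗≫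
        (fil ≫ gikl) ◁ sgijk.hom ▷ (tij ≫ ltjk ≫ llt) ⊗≫
        mik ▷ (gijk ≫ ci ≫ tij ≫ ltjk ≫ llt) ⊗≫
        fkl ◁ m ▷ (ci ≫ tij ≫ ltjk ≫ llt) ⊗≫
        𝟙 (fkl ≫ fjk ≫ fij ≫ ci ≫ tij ≫ ltjk ≫ llt) =
      𝟙 _ ⊗≫ cl ◁ nij ▷ lh ⊗≫ (cl ≫ pjl) ◁ sh.hom ⊗≫ cl ◁ njk ▷ pij ⊗≫
        zkl ▷ (pjk ≫ pij) ⊗≫ (fkl ≫ ck) ◁ sjk.inv ▷ pij ⊗≫ (fkl ≫ ck ≫ pjk) ◁ sll.inv ⊗≫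
        fkl ◁ zjk ▷ (pij ≫ llt) ⊗≫ (fkl ≫ fjk ≫ cj) ◁ st.inv ▷ llt ⊗≫
        (fkl ≫ fjk) ◁ zij ▷ (ltjk ≫ llt) ⊗≫ 𝟙 _ := by
  -- The bracket cube with its three conjugation squares moved to the other side, the form in which
  -- it occurs in the pasting.
  have hbr' : sik.inv ▷ hijk ⊗≫ pik ◁ br ⊗≫ n ▷ llt =
      (α_ _ _ _).hom ≫ tkl ◁ n ⊗≫ sjk.inv ▷ pij ⊗≫ pjk ◁ sll.inv ⊗≫ 𝟙 ((pjk ≫ pij) ≫ llt) := by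
    calc
      _ = sik.inv ▷ hijk ⊗≫ pik ◁ br ⊗≫ n ▷ llt ⊗≫ pjk ◁ (sll.hom ≫ 𝟙 _ ≫ sll.inv) ⊗≫ 𝟙 _ := by
        rw [Category.id_comp, sll.hom_inv_id]; bicategory
      _ = sik.inv ▷ hijk ⊗≫ (pik ◁ br ⊗≫ n ▷ llt ⊗≫ pjk ◁ sll.hom ⊗≫ sjk.hom ▷ pij) ⊗≫
          sjk.inv ▷ pij ⊗≫ pjk ◁ sll.inv ⊗≫ 𝟙 _ := by
        calc
          _ = sik.inv ▷ hijk ⊗≫ pik ◁ br ⊗≫ n ▷ llt ⊗≫ pjk ◁ sll.hom ⊗≫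
              (𝟙 (pjk ≫ lt)) ▷ pij ⊗≫ pjk ◁ sll.inv ⊗≫ 𝟙 _ := by bicategory
          _ = _ := by rw [← sjk.hom_inv_id]; bicategory
      _ = 𝟙 _ ⊗≫ (sik.inv ≫ sik.hom) ▷ hijk ⊗≫ tkl ◁ n ⊗≫
          sjk.inv ▷ pij ⊗≫ pjk ◁ sll.inv ⊗≫ 𝟙 _ := by
        rw [hbr]; bicategory
      _ = _ := by rw [sik.inv_hom_id]; bicategory
  calc
    _ = 𝟙 _ ⊗≫ (zil ▷ (hijl ≫ lh) ≫ (fil ≫ ci ≫ til) ◁ nu) ⊗≫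
        (fil ≫ ci) ◁ bik ▷ hijk ⊗≫
        fil ◁ (((ci ≫ rgikl) ◁ (tik ◁ br ⊗≫ b ▷ llt)) ≫
          sgikl.hom ▷ ((rgijk ≫ tij ≫ ltjk) ≫ llt)) ⊗≫
        ((fil ≫ gikl) ◁ (sgijk.hom ▷ (tij ≫ ltjk ≫ llt)) ≫
        mik ▷ ((gijk ≫ ci) ≫ tij ≫ ltjk ≫ llt)) ⊗≫
        fkl ◁ m ▷ (ci ≫ tij ≫ ltjk ≫ llt) ⊗≫
        𝟙 (fkl ≫ fjk ≫ fij ≫ ci ≫ tij ≫ ltjk ≫ llt) := by bicategory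
    _ = 𝟙 _ ⊗≫ ((cl ≫ pil) ◁ nu ≫ zil ▷ (hikl ≫ hijk)) ⊗≫
        (fil ≫ ci) ◁ bik ▷ hijk ⊗≫
        fil ◁ (sgikl.hom ▷ (tik ≫ ltik ≫ hijk) ≫
          (gikl ≫ ci) ◁ (tik ◁ br ⊗≫ b ▷ llt)) ⊗≫
        (mik ▷ ((ci ≫ rgijk) ≫ tij ≫ ltjk ≫ llt) ≫
          (fkl ≫ fik) ◁ (sgijk.hom ▷ (tij ≫ ltjk ≫ llt))) ⊗≫
        fkl ◁ m ▷ (ci ≫ tij ≫ ltjk ≫ llt) ⊗≫ 𝟙 _ := by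
      rw [← whisker_exchange zil, whisker_exchange sgikl.hom, whisker_exchange mik]
    _ = 𝟙 _ ⊗≫ ((cl ≫ pil) ◁ nu ≫ zil ▷ (hikl ≫ hijk)) ⊗≫
        (fil ≫ ci) ◁ bik ▷ hijk ⊗≫
        fil ◁ sgikl.hom ▷ (tik ≫ ltik ≫ hijk) ⊗≫
        ((fil ≫ gikl) ◁ (ci ◁ (tik ◁ br ⊗≫ b ▷ llt)) ≫
          mik ▷ (ci ≫ ((rgijk ≫ tij ≫ ltjk) ≫ llt))) ⊗≫
          (fkl ≫ fik) ◁ (sgijk.hom ▷ (tij ≫ ltjk ≫ llt)) ⊗≫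
        fkl ◁ m ▷ (ci ≫ tij ≫ ltjk ≫ llt) ⊗≫ 𝟙 _ := by bicategory
    -- Interchange has moved `nu` before `zil`, and `br` and `b` after `mik`, so the faces of the
    -- cube of `bik` are adjacent.
    _ = 𝟙 _ ⊗≫ (cl ≫ pil) ◁ nu ⊗≫
        (zil ▷ hikl ⊗≫ (fil ≫ ci) ◁ bik ⊗≫ fil ◁ sgikl.hom ▷ (tik ≫ ltik) ⊗≫
        mik ▷ (ci ≫ tik ≫ ltik) ≫ (α_ _ _ _).hom) ▷ hijk ⊗≫
        (fkl ≫ fik) ◁ (ci ◁ (tik ◁ br ⊗≫ b ▷ llt)) ⊗≫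
          (fkl ≫ fik) ◁ (sgijk.hom ▷ (tij ≫ ltjk ≫ llt)) ⊗≫
        fkl ◁ m ▷ (ci ≫ tij ≫ ltjk ≫ llt) ⊗≫ 𝟙 _ := by
      rw [whisker_exchange mik]; bicategory
    _ = 𝟙 _ ⊗≫ (cl ≫ pil) ◁ nu ⊗≫ cl ◁ nik ▷ hijk ⊗≫ zkl ▷ pik ▷ hijk ⊗≫
        (fkl ≫ ck) ◁ sik.inv ▷ hijk ⊗≫
        fkl ◁ (zik ▷ (ltik ≫ hijk) ≫ (fik ≫ ci ≫ tik) ◁ br) ⊗≫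
        fkl ◁ ((fik ≫ ci) ◁ b ⊗≫ fik ◁ sgijk.hom ▷ (tij ≫ ltjk) ⊗≫
          m ▷ (ci ≫ tij ≫ ltjk)) ▷ llt ⊗≫ 𝟙 _ := by
      rw [hbik]; bicategory
    -- Sliding `br` before `zik` makes the faces of the cube of `b` adjacent. Replacing them brings
    -- in `n`, which completes the left side of `hbr'`.
    _ = 𝟙 _ ⊗≫ (cl ≫ pil) ◁ nu ⊗≫ cl ◁ nik ▷ hijk ⊗≫ zkl ▷ pik ▷ hijk ⊗≫
        (fkl ≫ ck) ◁ sik.inv ▷ hijk ⊗≫ fkl ◁ (ck ≫ pik) ◁ br ⊗≫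
        fkl ◁ (zik ▷ hijk ⊗≫ (fik ≫ ci) ◁ b ⊗≫ fik ◁ sgijk.hom ▷ (tij ≫ ltjk) ⊗≫
          m ▷ (ci ≫ tij ≫ ltjk) ≫ (α_ _ _ _).hom) ▷ llt ⊗≫ 𝟙 _ := by
      rw [← whisker_exchange zik]; bicategory
    _ = 𝟙 _ ⊗≫ (cl ≫ pil) ◁ nu ⊗≫ cl ◁ nik ▷ hijk ⊗≫ zkl ▷ pik ▷ hijk ⊗≫
        (fkl ≫ ck) ◁ (sik.inv ▷ hijk ⊗≫ pik ◁ br ⊗≫ n ▷ llt) ⊗≫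
        fkl ◁ zjk ▷ (pij ≫ llt) ⊗≫ (fkl ≫ fjk ≫ cj) ◁ st.inv ▷ llt ⊗≫
        (fkl ≫ fjk) ◁ zij ▷ (ltjk ≫ llt) ⊗≫ 𝟙 _ := by
      rw [hb]; bicategory
    _ = 𝟙 _ ⊗≫ (cl ≫ pil) ◁ nu ⊗≫ cl ◁ nik ▷ hijk ⊗≫
        (zkl ▷ (pik ≫ hijk) ≫ (fkl ≫ ck ≫ tkl) ◁ n) ⊗≫
        (fkl ≫ ck) ◁ sjk.inv ▷ pij ⊗≫ (fkl ≫ ck ≫ pjk) ◁ sll.inv ⊗≫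
        fkl ◁ zjk ▷ (pij ≫ llt) ⊗≫ (fkl ≫ fjk ≫ cj) ◁ st.inv ▷ llt ⊗≫
        (fkl ≫ fjk) ◁ zij ▷ (ltjk ≫ llt) ⊗≫ 𝟙 _ := by
      rw [hbr']; bicategory
    -- Sliding `n` before `zkl` completes the left side of the cube of `ν'`.
    _ = 𝟙 _ ⊗≫ cl ◁ (pil ◁ nu ⊗≫ nik ▷ hijk ⊗≫ pkl ◁ n) ⊗≫
        zkl ▷ (pjk ≫ pij) ⊗≫
        (fkl ≫ ck) ◁ sjk.inv ▷ pij ⊗≫ (fkl ≫ ck ≫ pjk) ◁ sll.inv ⊗≫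
        fkl ◁ zjk ▷ (pij ≫ llt) ⊗≫ (fkl ≫ fjk ≫ cj) ◁ st.inv ▷ llt ⊗≫
        (fkl ≫ fjk) ◁ zij ▷ (ltjk ≫ llt) ⊗≫ 𝟙 _ := by
      rw [← whisker_exchange zkl]; bicategory
    _ = _ := by rw [hnu]; bicategory

/-- The side of `ν`, brought to the same normal form as in `second_composite`. Here `zij` and `br`
are isomorphisms because the bracket enters through its inverse and its cube is written with the
inverse of `zij`. The face `lb` is `λ' i j (b j k l)`, and `hlb` is its cube over `b`. -/
theorem first_composite
    (nij : pil ≫ hijl ⟶ pjl ≫ pij) (njk : pjl ≫ hjkl ⟶ pkl ≫ pjk)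
    (mij : fil ≫ gijl ⟶ fjl ≫ fij) (mjk : fjl ≫ gjkl ⟶ fkl ≫ fjk)
    (mik : fil ≫ gikl ⟶ fkl ≫ fik) (m : fik ≫ gijk ⟶ fjk ≫ fij)
    (zij : cj ≫ pij ≅ fij ≫ ci ≫ tij)
    (zil : cl ≫ pil ⟶ fil ≫ ci ≫ til) (zjk : ck ≫ pjk ⟶ fjk ≫ cj ≫ tjk)
    (zjl : cl ≫ pjl ⟶ fjl ≫ cj ≫ tjl)
    (zkl : cl ≫ pkl ⟶ fkl ≫ ck ≫ tkl)
    (sh : pij ≫ lh ≅ hjkl ≫ pij) (sjk : pjk ≫ lt ≅ tkl ≫ pjk)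
    (sll : pij ≫ llt ≅ lt ≫ pij) (st : pij ≫ ltjk ≅ tjk ≫ pij) (stl : pij ≫ ltjl ≅ tjl ≫ pij)
    (srg : pij ≫ lrg ≅ rgjkl ≫ pij) (slg : fij ≫ lg ≅ gjkl ≫ fij)
    (sgijl : ci ≫ rgijl ≅ gijl ≫ ci) (sgjkl : cj ≫ rgjkl ≅ gjkl ≫ cj)
    (srlg : ci ≫ rlg ≅ lg ≫ ci)
    (nu : gijl ≫ lg ⟶ gikl ≫ gijk)
    (hnu : fil ◁ nu ⊗≫ mik ▷ gijk ⊗≫ fkl ◁ m =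
      (α_ _ _ _).inv ≫ mij ▷ lg ⊗≫ fjl ◁ slg.hom ⊗≫ mjk ▷ fij ≫ (α_ _ _ _).hom)
    (br : rlg ≫ tij ≅ tij ≫ lrg)
    (hbr : (fij ≫ ci) ◁ br.hom ⊗≫ zij.inv ▷ lrg ⊗≫ cj ◁ srg.hom ⊗≫ sgjkl.hom ▷ pij =
      (α_ fij ci (rlg ≫ tij)).hom ≫ fij ◁ (α_ ci rlg tij).inv ≫
        fij ◁ srlg.hom ▷ tij ⊗≫ slg.hom ▷ (ci ≫ tij) ⊗≫ gjkl ◁ zij.inv ⊗≫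
        𝟙 ((gjkl ≫ cj) ≫ pij))
    (bil : til ≫ hijl ⟶ rgijl ≫ tij ≫ ltjl)
    (hbil : zil ▷ hijl ⊗≫ (fil ≫ ci) ◁ bil ⊗≫ fil ◁ sgijl.hom ▷ (tij ≫ ltjl) ⊗≫
        mij ▷ (ci ≫ tij ≫ ltjl) ≫ (α_ _ _ _).hom =
      (α_ _ _ _).hom ≫ cl ◁ nij ⊗≫ zjl ▷ pij ⊗≫ (fjl ≫ cj) ◁ stl.inv ⊗≫
        fjl ◁ zij.hom ▷ ltjl ⊗≫ 𝟙 (fjl ≫ fij ≫ ci ≫ tij ≫ ltjl))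
    (b : tjl ≫ hjkl ⟶ rgjkl ≫ tjk ≫ lt)
    (hb : zjl ▷ hjkl ⊗≫ (fjl ≫ cj) ◁ b ⊗≫ fjl ◁ sgjkl.hom ▷ (tjk ≫ lt) ⊗≫
        mjk ▷ (cj ≫ tjk ≫ lt) ≫ (α_ _ _ _).hom =
      (α_ _ _ _).hom ≫ cl ◁ njk ⊗≫ zkl ▷ pjk ⊗≫ (fkl ≫ ck) ◁ sjk.inv ⊗≫
        fkl ◁ zjk ▷ lt ⊗≫ 𝟙 (fkl ≫ fjk ≫ cj ≫ tjk ≫ lt))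
    (lb : ltjl ≫ lh ⟶ lrg ≫ ltjk ≫ llt)
    (hlb : pij ◁ lb ⊗≫ srg.hom ▷ (ltjk ≫ llt) ⊗≫ rgjkl ◁ st.hom ▷ llt ⊗≫
        (rgjkl ≫ tjk) ◁ sll.hom ⊗≫ 𝟙 ((rgjkl ≫ tjk ≫ lt) ≫ pij) =
      𝟙 _ ⊗≫ stl.hom ▷ lh ⊗≫ tjl ◁ sh.hom ⊗≫ b ▷ pij) :
    𝟙 ((cl ≫ pil) ≫ hijl ≫ lh) ⊗≫ zil ▷ (hijl ≫ lh) ⊗≫ (fil ≫ ci) ◁ bil ▷ lh ⊗≫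
        (fil ≫ ci ≫ rgijl ≫ tij) ◁ lb ⊗≫
        (fil ≫ ci ≫ rgijl) ◁ br.inv ▷ (ltjk ≫ llt) ⊗≫
        fil ◁ sgijl.hom ▷ (rlg ≫ tij ≫ ltjk ≫ llt) ⊗≫
        (fil ≫ gijl) ◁ srlg.hom ▷ (tij ≫ ltjk ≫ llt) ⊗≫
        fil ◁ nu ▷ (ci ≫ tij ≫ ltjk ≫ llt) ⊗≫
        mik ▷ (gijk ≫ ci ≫ tij ≫ ltjk ≫ llt) ⊗≫
        fkl ◁ m ▷ (ci ≫ tij ≫ ltjk ≫ llt) ⊗≫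
        𝟙 (fkl ≫ fjk ≫ fij ≫ ci ≫ tij ≫ ltjk ≫ llt) =
      𝟙 _ ⊗≫ cl ◁ nij ▷ lh ⊗≫ (cl ≫ pjl) ◁ sh.hom ⊗≫ cl ◁ njk ▷ pij ⊗≫
        zkl ▷ (pjk ≫ pij) ⊗≫ (fkl ≫ ck) ◁ sjk.inv ▷ pij ⊗≫ (fkl ≫ ck ≫ pjk) ◁ sll.inv ⊗≫
        fkl ◁ zjk ▷ (pij ≫ llt) ⊗≫ (fkl ≫ fjk ≫ cj) ◁ st.inv ▷ llt ⊗≫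
        (fkl ≫ fjk) ◁ zij.hom ▷ (ltjk ≫ llt) ⊗≫ 𝟙 _ := by
  have hbr' : zij.hom ▷ lrg ⊗≫ (fij ≫ ci) ◁ br.inv ⊗≫ fij ◁ srlg.hom ▷ tij ⊗≫
        slg.hom ▷ (ci ≫ tij) =
      𝟙 _ ⊗≫ cj ◁ srg.hom ⊗≫ sgjkl.hom ▷ pij ⊗≫ gjkl ◁ zij.hom ⊗≫ 𝟙 _ := by
    calc
      _ = zij.hom ▷ lrg ⊗≫ (fij ≫ ci) ◁ br.inv ⊗≫ fij ◁ srlg.hom ▷ tij ⊗≫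
          slg.hom ▷ (ci ≫ tij) ⊗≫ gjkl ◁ (zij.inv ≫ zij.hom) ⊗≫ 𝟙 _ := by
        rw [zij.inv_hom_id]; bicategory
      _ = zij.hom ▷ lrg ⊗≫ (fij ≫ ci) ◁ br.inv ⊗≫
          ((α_ fij ci (rlg ≫ tij)).hom ≫ fij ◁ (α_ ci rlg tij).inv ≫
            fij ◁ srlg.hom ▷ tij ⊗≫ slg.hom ▷ (ci ≫ tij) ⊗≫ gjkl ◁ zij.inv ⊗≫
            𝟙 ((gjkl ≫ cj) ≫ pij)) ⊗≫ gjkl ◁ zij.hom ⊗≫ 𝟙 _ := by bicategory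
      _ = zij.hom ▷ lrg ⊗≫ (fij ≫ ci) ◁ (br.inv ≫ br.hom) ⊗≫ zij.inv ▷ lrg ⊗≫
          cj ◁ srg.hom ⊗≫ sgjkl.hom ▷ pij ⊗≫ gjkl ◁ zij.hom ⊗≫ 𝟙 _ := by
        rw [← hbr]; bicategory
      _ = (zij.hom ≫ zij.inv) ▷ lrg ⊗≫
          cj ◁ srg.hom ⊗≫ sgjkl.hom ▷ pij ⊗≫ gjkl ◁ zij.hom ⊗≫ 𝟙 _ := by
        rw [br.inv_hom_id]; bicategory
      _ = _ := by rw [zij.hom_inv_id]; bicategory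
  -- This exchanges `lb` for `b`, with the squares of `ϑ j l`, `ϑ j k` and `λ' j k (ϑ k l)`
  -- inverted.
  have hlb' : stl.inv ▷ lh ⊗≫ pij ◁ lb ⊗≫ srg.hom ▷ (ltjk ≫ llt) =
      𝟙 _ ⊗≫ tjl ◁ sh.hom ⊗≫ b ▷ pij ⊗≫ (rgjkl ≫ tjk) ◁ sll.inv ⊗≫
        rgjkl ◁ st.inv ▷ llt ⊗≫ 𝟙 _ := by
    calc
      _ = stl.inv ▷ lh ⊗≫ pij ◁ lb ⊗≫ srg.hom ▷ (ltjk ≫ llt) ⊗≫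
          rgjkl ◁ (st.hom ≫ st.inv) ▷ llt ⊗≫ 𝟙 _ := by
        rw [st.hom_inv_id]; bicategory
      _ = stl.inv ▷ lh ⊗≫ pij ◁ lb ⊗≫ srg.hom ▷ (ltjk ≫ llt) ⊗≫
          rgjkl ◁ st.hom ▷ llt ⊗≫ (rgjkl ≫ tjk) ◁ (sll.hom ≫ sll.inv) ⊗≫
          rgjkl ◁ st.inv ▷ llt ⊗≫ 𝟙 _ := by
        rw [sll.hom_inv_id]; bicategory
      _ = stl.inv ▷ lh ⊗≫ (pij ◁ lb ⊗≫ srg.hom ▷ (ltjk ≫ llt) ⊗≫ rgjkl ◁ st.hom ▷ llt ⊗≫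
          (rgjkl ≫ tjk) ◁ sll.hom ⊗≫ 𝟙 ((rgjkl ≫ tjk ≫ lt) ≫ pij)) ⊗≫
          (rgjkl ≫ tjk) ◁ sll.inv ⊗≫ rgjkl ◁ st.inv ▷ llt ⊗≫ 𝟙 _ := by bicategory
      _ = 𝟙 _ ⊗≫ (stl.inv ≫ stl.hom) ▷ lh ⊗≫ tjl ◁ sh.hom ⊗≫ b ▷ pij ⊗≫
          (rgjkl ≫ tjk) ◁ sll.inv ⊗≫ rgjkl ◁ st.inv ▷ llt ⊗≫ 𝟙 _ := by
        rw [hlb]; bicategory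
      _ = _ := by rw [stl.inv_hom_id]; bicategory
  calc
    _ = 𝟙 _ ⊗≫ zil ▷ (hijl ≫ lh) ⊗≫ (fil ≫ ci) ◁ bil ▷ lh ⊗≫
        fil ◁ ((ci ≫ rgijl) ◁ (tij ◁ lb ⊗≫ br.inv ▷ (ltjk ≫ llt)) ≫
          sgijl.hom ▷ ((rlg ≫ tij) ≫ ltjk ≫ llt)) ⊗≫
        (fil ≫ gijl) ◁ srlg.hom ▷ (tij ≫ ltjk ≫ llt) ⊗≫
        (fil ◁ nu ⊗≫ mik ▷ gijk ⊗≫ fkl ◁ m) ▷ (ci ≫ tij ≫ ltjk ≫ llt) ⊗≫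
        𝟙 (fkl ≫ fjk ≫ fij ≫ ci ≫ tij ≫ ltjk ≫ llt) := by bicategory
    _ = 𝟙 _ ⊗≫ zil ▷ (hijl ≫ lh) ⊗≫ (fil ≫ ci) ◁ bil ▷ lh ⊗≫
        fil ◁ sgijl.hom ▷ (tij ≫ ltjl ≫ lh) ⊗≫
        ((fil ≫ gijl) ◁ (ci ◁ (tij ◁ lb ⊗≫ br.inv ▷ (ltjk ≫ llt)) ⊗≫
            srlg.hom ▷ (tij ≫ ltjk ≫ llt)) ≫
          mij ▷ ((lg ≫ ci) ≫ (tij ≫ ltjk ≫ llt))) ⊗≫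
        fjl ◁ slg.hom ▷ (ci ≫ tij ≫ ltjk ≫ llt) ⊗≫ mjk ▷ (fij ≫ ci ≫ tij ≫ ltjk ≫ llt) ⊗≫
        𝟙 (fkl ≫ fjk ≫ fij ≫ ci ≫ tij ≫ ltjk ≫ llt) := by
      rw [whisker_exchange sgijl.hom, hnu]; bicategory
    -- The cube of `ν` has produced `mij`. Sliding `lb`, `br.inv` and `srlg` past it makes the faces
    -- of the cube of `bil` adjacent.
    _ = 𝟙 _ ⊗≫ (zil ▷ hijl ⊗≫ (fil ≫ ci) ◁ bil ⊗≫ fil ◁ sgijl.hom ▷ (tij ≫ ltjl) ⊗≫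
          mij ▷ (ci ≫ tij ≫ ltjl) ≫ (α_ _ _ _).hom) ▷ lh ⊗≫
        (fjl ≫ fij ≫ ci ≫ tij) ◁ lb ⊗≫ (fjl ≫ fij ≫ ci) ◁ br.inv ▷ (ltjk ≫ llt) ⊗≫
        (fjl ≫ fij) ◁ srlg.hom ▷ (tij ≫ ltjk ≫ llt) ⊗≫
        fjl ◁ slg.hom ▷ (ci ≫ tij ≫ ltjk ≫ llt) ⊗≫ mjk ▷ (fij ≫ ci ≫ tij ≫ ltjk ≫ llt) ⊗≫
        𝟙 (fkl ≫ fjk ≫ fij ≫ ci ≫ tij ≫ ltjk ≫ llt) := by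
      rw [whisker_exchange mij]; bicategory
    _ = 𝟙 _ ⊗≫ cl ◁ nij ▷ lh ⊗≫ zjl ▷ (pij ≫ lh) ⊗≫ (fjl ≫ cj) ◁ stl.inv ▷ lh ⊗≫
        fjl ◁ (zij.hom ▷ (ltjl ≫ lh) ≫ (fij ≫ ci ≫ tij) ◁ lb) ⊗≫
        fjl ◁ ((fij ≫ ci) ◁ br.inv ⊗≫ fij ◁ srlg.hom ▷ tij ⊗≫
          slg.hom ▷ (ci ≫ tij)) ▷ (ltjk ≫ llt) ⊗≫
        mjk ▷ (fij ≫ ci ≫ tij ≫ ltjk ≫ llt) ⊗≫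
        𝟙 (fkl ≫ fjk ≫ fij ≫ ci ≫ tij ≫ ltjk ≫ llt) := by
      rw [hbil]; bicategory
    -- Once `lb` precedes `zij.hom`, the bracket cube `hbr'` applies. It supplies `srg.hom`, which
    -- completes the left side of `hlb'`.
    _ = 𝟙 _ ⊗≫ cl ◁ nij ▷ lh ⊗≫ zjl ▷ (pij ≫ lh) ⊗≫ (fjl ≫ cj) ◁ stl.inv ▷ lh ⊗≫
        (fjl ≫ cj ≫ pij) ◁ lb ⊗≫
        fjl ◁ (zij.hom ▷ lrg ⊗≫ (fij ≫ ci) ◁ br.inv ⊗≫ fij ◁ srlg.hom ▷ tij ⊗≫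
          slg.hom ▷ (ci ≫ tij)) ▷ (ltjk ≫ llt) ⊗≫
        mjk ▷ (fij ≫ ci ≫ tij ≫ ltjk ≫ llt) ⊗≫
        𝟙 (fkl ≫ fjk ≫ fij ≫ ci ≫ tij ≫ ltjk ≫ llt) := by
      rw [← whisker_exchange zij.hom]; bicategory
    _ = 𝟙 _ ⊗≫ cl ◁ nij ▷ lh ⊗≫ zjl ▷ (pij ≫ lh) ⊗≫
        (fjl ≫ cj) ◁ (stl.inv ▷ lh ⊗≫ pij ◁ lb ⊗≫ srg.hom ▷ (ltjk ≫ llt)) ⊗≫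
        fjl ◁ sgjkl.hom ▷ (pij ≫ ltjk ≫ llt) ⊗≫
        ((fjl ≫ gjkl) ◁ zij.hom ▷ (ltjk ≫ llt) ≫
          mjk ▷ ((fij ≫ ci ≫ tij) ≫ ltjk ≫ llt)) ⊗≫
        𝟙 (fkl ≫ fjk ≫ fij ≫ ci ≫ tij ≫ ltjk ≫ llt) := by
      rw [hbr']; bicategory
    _ = 𝟙 _ ⊗≫ cl ◁ nij ▷ lh ⊗≫ (zjl ▷ (pij ≫ lh) ≫
        (fjl ≫ cj ≫ tjl) ◁ sh.hom) ⊗≫ (fjl ≫ cj) ◁ b ▷ pij ⊗≫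
        fjl ◁ ((cj ≫ rgjkl) ◁ (tjk ◁ sll.inv ⊗≫ st.inv ▷ llt) ≫
          sgjkl.hom ▷ ((pij ≫ ltjk) ≫ llt)) ⊗≫
        mjk ▷ (cj ≫ pij ≫ ltjk ≫ llt) ⊗≫ (fkl ≫ fjk) ◁ zij.hom ▷ (ltjk ≫ llt) ⊗≫
        𝟙 (fkl ≫ fjk ≫ fij ≫ ci ≫ tij ≫ ltjk ≫ llt) := by
      rw [hlb', whisker_exchange mjk]; bicategory
    _ = 𝟙 _ ⊗≫ cl ◁ nij ▷ lh ⊗≫ (cl ≫ pjl) ◁ sh.hom ⊗≫ zjl ▷ (hjkl ≫ pij) ⊗≫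
        (fjl ≫ cj) ◁ b ▷ pij ⊗≫ fjl ◁ sgjkl.hom ▷ (tjk ≫ lt ≫ pij) ⊗≫
        ((fjl ≫ gjkl) ◁ (cj ◁ (tjk ◁ sll.inv ⊗≫ st.inv ▷ llt)) ≫
          mjk ▷ (cj ≫ ((pij ≫ ltjk) ≫ llt))) ⊗≫ (fkl ≫ fjk) ◁ zij.hom ▷ (ltjk ≫ llt) ⊗≫
        𝟙 (fkl ≫ fjk ≫ fij ≫ ci ≫ tij ≫ ltjk ≫ llt) := by
      rw [← whisker_exchange zjl, whisker_exchange sgjkl.hom]; bicategory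
    -- The inverse squares `sll.inv` and `st.inv` have been slid past `sgjkl` and `mjk`, leaving the
    -- faces of the cube of `b` adjacent.
    _ = 𝟙 _ ⊗≫ cl ◁ nij ▷ lh ⊗≫ (cl ≫ pjl) ◁ sh.hom ⊗≫
        (zjl ▷ hjkl ⊗≫ (fjl ≫ cj) ◁ b ⊗≫ fjl ◁ sgjkl.hom ▷ (tjk ≫ lt) ⊗≫
          mjk ▷ (cj ≫ tjk ≫ lt) ≫ (α_ _ _ _).hom) ▷ pij ⊗≫
        (fkl ≫ fjk ≫ cj ≫ tjk) ◁ sll.inv ⊗≫ (fkl ≫ fjk ≫ cj) ◁ st.inv ▷ llt ⊗≫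
        (fkl ≫ fjk) ◁ zij.hom ▷ (ltjk ≫ llt) ⊗≫ 𝟙 _ := by
      rw [whisker_exchange mjk]; bicategory
    _ = 𝟙 _ ⊗≫ cl ◁ nij ▷ lh ⊗≫ (cl ≫ pjl) ◁ sh.hom ⊗≫ cl ◁ njk ▷ pij ⊗≫
        zkl ▷ (pjk ≫ pij) ⊗≫ (fkl ≫ ck) ◁ sjk.inv ▷ pij ⊗≫
        fkl ◁ (zjk ▷ (lt ≫ pij) ≫ (fjk ≫ cj ≫ tjk) ◁ sll.inv) ⊗≫
        (fkl ≫ fjk ≫ cj) ◁ st.inv ▷ llt ⊗≫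
        (fkl ≫ fjk) ◁ zij.hom ▷ (ltjk ≫ llt) ⊗≫ 𝟙 _ := by
      rw [hb]; bicategory
    _ = _ := by rw [← whisker_exchange zjk]; bicategory

end

/-! ### Cubes for conjugated 2-arrows with monoidal constraints. -/

namespace QuasiInverse

variable {B : Type u} [Bicategory.{w, v} B] {a b : B} {f : a ⟶ b} (F : QuasiInverse f)

theorem conjComp_inv_sq (p q : a ⟶ a) :
    f ◁ (F.conjComp p q).inv ≫ (F.sq (p ≫ q)).hom =
      (α_ _ _ _).inv ≫ (F.sq p).hom ▷ F.conj q ≫ (α_ _ _ _).hom ≫ p ◁ (F.sq q).hom ≫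
        (α_ _ _ _).inv := by
  rw [← cancel_mono (α_ _ _ _).hom, Category.assoc, ← F.conjComp_sq]
  simp

/-- Gives the cube of `r i (ν i j k l)`: compatibility with the constraints merges the two squares
on each side into the square of the composite, where naturality applies. -/
theorem conjMap_comp_sq {p q p' q' : a ⟶ a} (η : p ≫ q ⟶ p' ≫ q') :
    f ◁ ((F.conjComp p q).inv ≫ F.conjMap η ≫ (F.conjComp p' q').hom) ⊗≫
        (F.sq p').hom ▷ F.conj q' ⊗≫ p' ◁ (F.sq q').hom =
      𝟙 _ ⊗≫ (F.sq p).hom ▷ F.conj q ⊗≫ p ◁ (F.sq q).hom ⊗≫ η ▷ f ⊗≫ 𝟙 _ := by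
  calc
    _ = f ◁ (F.conjComp p q).inv ≫ f ◁ F.conjMap η ≫ (f ◁ (F.conjComp p' q').hom ≫
        (α_ _ _ _).inv ≫ (F.sq p').hom ▷ F.conj q' ≫ (α_ _ _ _).hom ≫
        p' ◁ (F.sq q').hom) := by bicategory
    _ = f ◁ (F.conjComp p q).inv ≫ (F.sq (p ≫ q)).hom ≫ η ▷ f ≫ (α_ _ _ _).hom := by
      rw [conjComp_sq, reassoc_of% F.conjMap_sq η]
    _ = _ := by rw [reassoc_of% F.conjComp_inv_sq p q]; bicategory

/-- The variant needed for `λ' i j (b j k l)`, whose target has three factors. The second constraint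
is absorbed into the square of `q' ≫ r'`, which reduces to the case of two factors. -/
theorem conjMap_comp₃_sq {p q p' q' r' : a ⟶ a} (η : p ≫ q ⟶ p' ≫ q' ≫ r') :
    f ◁ ((F.conjComp p q).inv ≫ F.conjMap η ≫ (F.conjComp p' (q' ≫ r')).hom ≫
          F.conj p' ◁ (F.conjComp q' r').hom) ⊗≫
        (F.sq p').hom ▷ (F.conj q' ≫ F.conj r') ⊗≫ p' ◁ (F.sq q').hom ▷ F.conj r' ⊗≫
        (p' ≫ q') ◁ (F.sq r').hom ⊗≫ 𝟙 ((p' ≫ q' ≫ r') ≫ f) =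
      𝟙 _ ⊗≫ (F.sq p).hom ▷ F.conj q ⊗≫ p ◁ (F.sq q).hom ⊗≫ η ▷ f := by
  calc
    _ = f ◁ ((F.conjComp p q).inv ≫ F.conjMap η ≫ (F.conjComp p' (q' ≫ r')).hom) ⊗≫
        ((f ≫ F.conj p') ◁ (F.conjComp q' r').hom ≫
          (F.sq p').hom ▷ (F.conj q' ≫ F.conj r')) ⊗≫ p' ◁ (F.sq q').hom ▷ F.conj r' ⊗≫
        (p' ≫ q') ◁ (F.sq r').hom ⊗≫ 𝟙 _ := by bicategory
    _ = f ◁ ((F.conjComp p q).inv ≫ F.conjMap η ≫ (F.conjComp p' (q' ≫ r')).hom) ⊗≫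
        (F.sq p').hom ▷ F.conj (q' ≫ r') ⊗≫ p' ◁ (f ◁ (F.conjComp q' r').hom ≫ (α_ _ _ _).inv ≫
          (F.sq q').hom ▷ F.conj r' ≫ (α_ _ _ _).hom ≫ q' ◁ (F.sq r').hom) ⊗≫ 𝟙 _ := by
      rw [whisker_exchange]; bicategory
    _ = (f ◁ ((F.conjComp p q).inv ≫ F.conjMap η ≫ (F.conjComp p' (q' ≫ r')).hom) ⊗≫
        (F.sq p').hom ▷ F.conj (q' ≫ r') ⊗≫ p' ◁ (F.sq (q' ≫ r')).hom) ⊗≫ 𝟙 _ := by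
      rw [conjComp_sq]; bicategory
    _ = _ := by rw [conjMap_comp_sq]; bicategory

end QuasiInverse

theorem whiskerLeft_injective {B : Type u} [Bicategory.{w, v} B] [IsTwoGroupoid B] {a b c : B}
    (f : a ⟶ b) {p q : b ⟶ c} {η θ : p ⟶ q} (h : f ◁ η = f ◁ θ) : η = θ :=
  (existsUnique_whiskerLeft f (f ◁ θ)).unique h rfl

/-! ### From the full cube to the coboundary equation. -/

section

variable {B : Type u} [Bicategory.{w, v} B] [IsTwoGroupoid B] {xi yi : B}
  {gijk gikl gijl lg : xi ⟶ xi} {hijk hikl hijl : yi ⟶ yi} {ci : xi ⟶ yi}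
  {tij tik til lh ltjk ltjl llt ltik lrg rlg rgikl rgijk rgijl : yi ⟶ yi}

/-- Whiskering with `ci` is faithful, and the squares of `gikl` and `gijk` can be cancelled because
they are invertible. After pasting them on, `hrnu` replaces `rnu` by `nu` and the squares of `gijl`
and `lg`, and the equation becomes the full cube. -/
theorem coboundary_of_cube
    (sgikl : ci ≫ rgikl ≅ gikl ≫ ci) (sgijk : ci ≫ rgijk ≅ gijk ≫ ci)
    (sgijl : ci ≫ rgijl ≅ gijl ≫ ci) (srlg : ci ≫ rlg ≅ lg ≫ ci)
    (nu : gijl ≫ lg ⟶ gikl ≫ gijk) (nu' : hijl ≫ lh ⟶ hikl ≫ hijk)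
    (br' : ltik ≫ hijk ⟶ hijk ≫ llt) (br : rlg ≫ tij ⟶ tij ≫ lrg)
    (bil : til ≫ hijl ⟶ rgijl ≫ tij ≫ ltjl) (bik : til ≫ hikl ⟶ rgikl ≫ tik ≫ ltik)
    (b : tik ≫ hijk ⟶ rgijk ≫ tij ≫ ltjk) (lb : ltjl ≫ lh ⟶ lrg ≫ ltjk ≫ llt)
    (rnu : rgijl ≫ rlg ⟶ rgikl ≫ rgijk)
    (hrnu : ci ◁ rnu ⊗≫ sgikl.hom ▷ rgijk ⊗≫ gikl ◁ sgijk.hom =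
      𝟙 _ ⊗≫ sgijl.hom ▷ rlg ⊗≫ gijl ◁ srlg.hom ⊗≫ nu ▷ ci ⊗≫ 𝟙 _)
    (hcube : ci ◁ bil ▷ lh ⊗≫ (ci ≫ rgijl ≫ tij) ◁ lb ⊗≫
        (ci ≫ rgijl) ◁ inv br ▷ (ltjk ≫ llt) ⊗≫
        sgijl.hom ▷ (rlg ≫ tij ≫ ltjk ≫ llt) ⊗≫ gijl ◁ srlg.hom ▷ (tij ≫ ltjk ≫ llt) ⊗≫
        nu ▷ (ci ≫ tij ≫ ltjk ≫ llt) ≫ (α_ _ _ _).hom =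
      𝟙 (ci ≫ (til ≫ hijl) ≫ lh) ⊗≫ (ci ≫ til) ◁ nu' ⊗≫ ci ◁ bik ▷ hijk ⊗≫
        (ci ≫ rgikl ≫ tik) ◁ br' ⊗≫ (ci ≫ rgikl) ◁ b ▷ llt ⊗≫
        sgikl.hom ▷ (rgijk ≫ tij ≫ ltjk ≫ llt) ⊗≫ gikl ◁ sgijk.hom ▷ (tij ≫ ltjk ≫ llt) ⊗≫
        𝟙 (gikl ≫ gijk ≫ ci ≫ tij ≫ ltjk ≫ llt)) :
    bil ▷ lh ⊗≫ (rgijl ≫ tij) ◁ lb ⊗≫ rgijl ◁ inv br ▷ (ltjk ≫ llt) ⊗≫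
        rnu ▷ (tij ≫ ltjk ≫ llt) ≫ (α_ _ _ _).hom =
      (α_ _ _ _).hom ≫ til ◁ nu' ⊗≫ bik ▷ hijk ⊗≫ (rgikl ≫ tik) ◁ br' ⊗≫ rgikl ◁ b ▷ llt ⊗≫
        𝟙 (rgikl ≫ rgijk ≫ tij ≫ ltjk ≫ llt) := by
  apply whiskerLeft_injective ci
  rw [← cancel_mono (𝟙 _ ⊗≫ sgikl.hom ▷ (rgijk ≫ tij ≫ ltjk ≫ llt) ⊗≫
    gikl ◁ sgijk.hom ▷ (tij ≫ ltjk ≫ llt) ⊗≫ 𝟙 (gikl ≫ gijk ≫ ci ≫ tij ≫ ltjk ≫ llt))]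
  calc
    _ = ci ◁ bil ▷ lh ⊗≫ (ci ≫ rgijl ≫ tij) ◁ lb ⊗≫
        (ci ≫ rgijl) ◁ inv br ▷ (ltjk ≫ llt) ⊗≫
        (ci ◁ rnu ⊗≫ sgikl.hom ▷ rgijk ⊗≫ gikl ◁ sgijk.hom) ▷ (tij ≫ ltjk ≫ llt) ⊗≫
        𝟙 (gikl ≫ gijk ≫ ci ≫ tij ≫ ltjk ≫ llt) := by
      bicategory
    _ = ci ◁ bil ▷ lh ⊗≫ (ci ≫ rgijl ≫ tij) ◁ lb ⊗≫
        (ci ≫ rgijl) ◁ inv br ▷ (ltjk ≫ llt) ⊗≫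
        sgijl.hom ▷ (rlg ≫ tij ≫ ltjk ≫ llt) ⊗≫ gijl ◁ srlg.hom ▷ (tij ≫ ltjk ≫ llt) ⊗≫
        nu ▷ (ci ≫ tij ≫ ltjk ≫ llt) ≫ (α_ _ _ _).hom := by
      rw [hrnu]; bicategory
    _ = _ := by rw [hcube]; bicategory

end

end TwoGerbes

/-! ### The main theorem. -/

open TwoGerbes

theorem lemma6p9 {X : Type t} [TopologicalSpace X] {I : Type s}
    (P : TwoGerbes.FiberedTwoCategory.{w, v, u, t} X) (U : I → Opens X)
    (T T' : TwoGerbes.Trivialization P U) (K : TwoGerbes.Comparison T T') (i j k l : I)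
    (V : Opens X) (hi : V ≤ U i) (hj : V ≤ U j) (hk : V ≤ U k) (hl : V ≤ U l) :
    -- the full cube commutes
    (K.χr hi ◁ K.b hi hj hl ▷ T'.lam hi hj (T'.gr hj hk hl) ⊗≫
        (K.χr hi ≫ K.r hi (T.gr hi hj hl) ≫ K.ϑr hi hj) ◁ K.lamB hi hj hk hl ⊗≫
        (K.χr hi ≫ K.r hi (T.gr hi hj hl)) ◁ inv (K.ζBracket hi hj (T.gr hj hk hl)) ▷
          (T'.lam hi hj (K.ϑr hj hk) ≫ T'.lam hi hj (T'.lam hj hk (K.ϑr hk hl))) ⊗≫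
        (K.sq hi (T.gr hi hj hl)).hom ▷ (K.r hi (T.lam hi hj (T.gr hj hk hl)) ≫ K.ϑr hi hj ≫
          T'.lam hi hj (K.ϑr hj hk) ≫ T'.lam hi hj (T'.lam hj hk (K.ϑr hk hl))) ⊗≫
        T.gr hi hj hl ◁ (K.sq hi (T.lam hi hj (T.gr hj hk hl))).hom ▷ (K.ϑr hi hj ≫
          T'.lam hi hj (K.ϑr hj hk) ≫ T'.lam hi hj (T'.lam hj hk (K.ϑr hk hl))) ⊗≫
        T.nu hi hj hk hl ▷ (K.χr hi ≫ K.ϑr hi hj ≫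
          T'.lam hi hj (K.ϑr hj hk) ≫ T'.lam hi hj (T'.lam hj hk (K.ϑr hk hl))) ≫
        (α_ _ _ _).hom =
      𝟙 (K.χr hi ≫ (K.ϑr hi hl ≫ T'.gr hi hj hl) ≫ T'.lam hi hj (T'.gr hj hk hl)) ⊗≫
        (K.χr hi ≫ K.ϑr hi hl) ◁ T'.nu hi hj hk hl ⊗≫
        K.χr hi ◁ K.b hi hk hl ▷ T'.gr hi hj hk ⊗≫
        (K.χr hi ≫ K.r hi (T.gr hi hk hl) ≫ K.ϑr hi hk) ◁ T'.mBracket hi hj hk (K.ϑr hk hl) ⊗≫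
        (K.χr hi ≫ K.r hi (T.gr hi hk hl)) ◁ K.b hi hj hk ▷
          T'.lam hi hj (T'.lam hj hk (K.ϑr hk hl)) ⊗≫
        (K.sq hi (T.gr hi hk hl)).hom ▷ (K.r hi (T.gr hi hj hk) ≫ K.ϑr hi hj ≫
          T'.lam hi hj (K.ϑr hj hk) ≫ T'.lam hi hj (T'.lam hj hk (K.ϑr hk hl))) ⊗≫
        T.gr hi hk hl ◁ (K.sq hi (T.gr hi hj hk)).hom ▷ (K.ϑr hi hj ≫
          T'.lam hi hj (K.ϑr hj hk) ≫ T'.lam hi hj (T'.lam hj hk (K.ϑr hk hl))) ⊗≫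
        𝟙 (T.gr hi hk hl ≫ T.gr hi hj hk ≫ K.χr hi ≫ K.ϑr hi hj ≫
          T'.lam hi hj (K.ϑr hj hk) ≫ T'.lam hi hj (T'.lam hj hk (K.ϑr hk hl)))) ∧
    -- the coboundary equation
    (K.b hi hj hl ▷ T'.lam hi hj (T'.gr hj hk hl) ⊗≫
        (K.r hi (T.gr hi hj hl) ≫ K.ϑr hi hj) ◁ K.lamB hi hj hk hl ⊗≫
        K.r hi (T.gr hi hj hl) ◁ inv (K.ζBracket hi hj (T.gr hj hk hl)) ▷
          (T'.lam hi hj (K.ϑr hj hk) ≫ T'.lam hi hj (T'.lam hj hk (K.ϑr hk hl))) ⊗≫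
        K.rNu hi hj hk hl ▷ (K.ϑr hi hj ≫
          T'.lam hi hj (K.ϑr hj hk) ≫ T'.lam hi hj (T'.lam hj hk (K.ϑr hk hl))) ≫
        (α_ _ _ _).hom =
      (α_ _ _ _).hom ≫ K.ϑr hi hl ◁ T'.nu hi hj hk hl ⊗≫
        K.b hi hk hl ▷ T'.gr hi hj hk ⊗≫
        (K.r hi (T.gr hi hk hl) ≫ K.ϑr hi hk) ◁ T'.mBracket hi hj hk (K.ϑr hk hl) ⊗≫
        K.r hi (T.gr hi hk hl) ◁ K.b hi hj hk ▷ T'.lam hi hj (T'.lam hj hk (K.ϑr hk hl)) ⊗≫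
        𝟙 (K.r hi (T.gr hi hk hl) ≫ K.r hi (T.gr hi hj hk) ≫ K.ϑr hi hj ≫
          T'.lam hi hj (K.ϑr hj hk) ≫ T'.lam hi hj (T'.lam hj hk (K.ϑr hk hl)))) := by
  have hnu : T.IsNu hi hj hk hl (T.nu hi hj hk hl) :=
    (T.existsUnique_isNu hi hj hk hl).choose_spec.1
  have hnu' : T'.IsNu hi hj hk hl (T'.nu hi hj hk hl) :=
    (T'.existsUnique_isNu hi hj hk hl).choose_spec.1
  have hb {i j k : I} (hi : V ≤ U i) (hj : V ≤ U j) (hk : V ≤ U k) :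
      K.IsB hi hj hk (K.b hi hj hk) := (K.existsUnique_isB hi hj hk).choose_spec.1
  have hm : IsBracket _ _ _ _ _ (T'.mBracket hi hj hk (K.ϑr hk hl)) :=
    (existsUnique_isBracket (T'.mr hi hj hk) (T'.φrInv hi hk) (T'.φrInv hj hk)
      (T'.φrInv hi hj) (K.ϑr hk hl)).choose_spec.1
  have hz : IsBracket' _ _ _ _ _ _ (K.ζBracket hi hj (T.gr hj hk hl)) :=
    (existsUnique_isBracket' (K.ζr hi hj) (K.χrInv hj) (T'.φrInv hi hj) (T.φrInv hi hj)
      (K.χrInv hi) (T.gr hj hk hl)).choose_spec.1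
  have hsecond := second_composite (T'.mr hi hj hl) (T'.mr hj hk hl) (T'.mr hi hk hl)
    (T'.mr hi hj hk) (T.mr hi hk hl) (T.mr hi hj hk) (K.ζr hi hj) (K.ζr hi hk) (K.ζr hi hl)
    (K.ζr hj hk) (K.ζr hk hl) (T'.sq hi hj (T'.gr hj hk hl)) (T'.sq hi hk (K.ϑr hk hl))
    (T'.sq hj hk (K.ϑr hk hl)) (T'.sq hi hj (T'.lam hj hk (K.ϑr hk hl)))
    (T'.sq hi hj (K.ϑr hj hk)) (K.sq hi (T.gr hi hk hl)) (K.sq hi (T.gr hi hj hk))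
    (T'.nu hi hj hk hl) hnu' (T'.mBracket hi hj hk (K.ϑr hk hl)) hm
    (K.b hi hk hl) (hb hi hk hl) (K.b hi hj hk) (hb hi hj hk)
  have hfirst := first_composite (T'.mr hi hj hl) (T'.mr hj hk hl)
    (T.mr hi hj hl) (T.mr hj hk hl) (T.mr hi hk hl) (T.mr hi hj hk) (asIso (K.ζr hi hj))
    (K.ζr hi hl) (K.ζr hj hk) (K.ζr hj hl) (K.ζr hk hl) (T'.sq hi hj (T'.gr hj hk hl))
    (T'.sq hj hk (K.ϑr hk hl)) (T'.sq hi hj (T'.lam hj hk (K.ϑr hk hl)))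
    (T'.sq hi hj (K.ϑr hj hk)) (T'.sq hi hj (K.ϑr hj hl))
    (T'.sq hi hj (K.r hj (T.gr hj hk hl))) (T.sq hi hj (T.gr hj hk hl))
    (K.sq hi (T.gr hi hj hl)) (K.sq hj (T.gr hj hk hl))
    (K.sq hi (T.lam hi hj (T.gr hj hk hl)))
    (T.nu hi hj hk hl) hnu (asIso (K.ζBracket hi hj (T.gr hj hk hl))) hz
    (K.b hi hj hl) (hb hi hj hl) (K.b hj hk hl) (hb hj hk hl) (K.lamB hi hj hk hl)
    ((T'.φrInv hi hj).conjMap_comp₃_sq (K.b hj hk hl))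
  -- The full cube implies the coboundary equation, so only the former remains to be proved.
  refine (and_iff_left_of_imp fun h => coboundary_of_cube (K.sq hi (T.gr hi hk hl))
    (K.sq hi (T.gr hi hj hk)) (K.sq hi (T.gr hi hj hl)) (K.sq hi (T.lam hi hj (T.gr hj hk hl)))
    (T.nu hi hj hk hl) (T'.nu hi hj hk hl) (T'.mBracket hi hj hk (K.ϑr hk hl))
    (K.ζBracket hi hj (T.gr hj hk hl)) (K.b hi hj hl) (K.b hi hk hl) (K.b hi hj hk)
    (K.lamB hi hj hk hl) (K.rNu hi hj hk hl)
    ((K.χrInv hi).conjMap_comp_sq (T.nu hi hj hk hl)) h).2 ?_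
  apply whiskerLeft_injective (T.φr hi hl)
  -- The pasted 2-arrows are invertible, hence cancellable. They supply the faces `ζ i l`, `m i k l`
  -- and `m i j k` that the defining cubes need.
  rw [← cancel_epi (𝟙 ((K.χr hl ≫ T'.φr hi hl) ≫ T'.gr hi hj hl ≫
        T'.lam hi hj (T'.gr hj hk hl)) ⊗≫
      K.ζr hi hl ▷ (T'.gr hi hj hl ≫ T'.lam hi hj (T'.gr hj hk hl)) ⊗≫ 𝟙 _),
    ← cancel_mono (𝟙 _ ⊗≫ T.mr hi hk hl ▷ (T.gr hi hj hk ≫ K.χr hi ≫ K.ϑr hi hj ≫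
        T'.lam hi hj (K.ϑr hj hk) ≫ T'.lam hi hj (T'.lam hj hk (K.ϑr hk hl))) ⊗≫
      T.φr hk hl ◁ T.mr hi hj hk ▷ (K.χr hi ≫ K.ϑr hi hj ≫
        T'.lam hi hj (K.ϑr hj hk) ≫ T'.lam hi hj (T'.lam hj hk (K.ϑr hk hl))) ⊗≫
      𝟙 (T.φr hk hl ≫ T.φr hj hk ≫ T.φr hi hj ≫ K.χr hi ≫ K.ϑr hi hj ≫
        T'.lam hi hj (K.ϑr hj hk) ≫ T'.lam hi hj (T'.lam hj hk (K.ϑr hk hl))))]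
  refine Eq.trans ?_ ((hfirst.trans hsecond.symm).trans ?_)
  · simp only [asIso_inv]
    bicategory
  · bicategory
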